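/- Let $(V,\langle\cdot,\cdot\rangle)$ be a finite-dimensional Euclidean space, with Clifford algebra $C\ell(V)$ defined by $v\cdot w+w\cdot v=-2\langle v,w\rangle$, and let $S=S_0\oplus S_1$ be a finite-dimensional $\mathbb Z_2$-graded $C\ell(V)$-module with a Euclidean scalar product such that $S_0\perp S_1$ and each Clifford multiplication $\mu(v,\cdot)$, $v\in V$, is skew-symmetric. Let $\mathscr A$ be the associated special $T$-algebra of $3\times3$ matrices $$\begin{pmatrix}x_1&s_0&s_1\\ t_0^\flat&x_2&v\\ t_1^\flat&w^\flat&x_3\end{pmatrix},\qquad x_i\in\mathbb R,\ v,w\in V,\ s_0,t_0\in S_0,\ s_1,t_1\in S_1,$$ with involution $*$ exchanging $(s_0,s_1,v)$ and $(t_0,t_1,w)$, and with the matrix product built from the multiplication by scalars, $x\cdot y^\flat=x^\flat\cdot y=\langle x,y\rangle$, $s_0\cdot v=\mu(v,s_0)$, $\langle s_0^\flat\cdot s_1,v\rangle=\langle s_1\cdot v^\flat,s_0\rangle=\langle\mu(v,s_0),s_1\rangle$, and $a\cdot b=(b^*\cdot a^*)^*$. Let $\mathscr H=\{X: X=X^*\}$,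 $\mathscr H'=\operatorname{Hom}(\mathscr H,\mathbb R)$, $X^\flat=\operatorname{tr}(X\cdot\,)\in\mathscr H'$, let $I$ be the identity matrix and let $y_1(\xi)=\xi(E_{11})$ for $\xi\in\mathscr H'$. Let $G_0$ be the unimodular triangular group, acting on $\mathscr H$ by the operators $A=\exp(T_B)$, $T_BX=BX+XB^*$, $B$ upper triangular of trace $0$, and on $\mathscr H'$ by $A'\xi=\xi\circ A^{-1}$ (the orbit of $I$ under $\mathbb R_+\times G_0$ is the special Vinberg cone of $(V,S)$; it need not be symmetric). Let $d:\mathscr H\to\mathbb R$ be an invariant cubic, i.e. a nonzero polynomial with $d(tA(X))=t^3d(X)$ for all $t>0$, $A\in G_0$, and let $d'+\mathfrak d'$ be a dual invariant cubic rational function, i.e. a nonzero rational function on $\mathscr H'$ with $(d'+\mathfrak d')(tA'(\xi))=t^3(d'+\mathfrak d')(\xi)$ for all $t>0$, $A\in G_0$, wherever both sides are defined. Assume $k=d(I)>0$ and $k'=(d'+\mathfrak d')(I^\flat)>0$. Then, for $X\in\mathscr H$ with entries $x_i,v,s_0,s_1$, $$d(X)=k\big(x_1x_2x_3-x_1|v|^2-x_2|s_1|^2-x_3|s_0|^2+2\langle\mu(v,s_0),s_1\rangle\big),$$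 and, if $x_1\ne0$, $d'+\mathfrak d'$ is defined at $X^\flat$ and $$(d'+\mathfrak d')(X^\flat)=k'\Big(x_1x_2x_3-x_1|v|^2-x_2|s_1|^2-x_3|s_0|^2+2\langle\mu(v,s_0),s_1\rangle+\frac{|s_0|^2|s_1|^2-|s_0^\flat\cdot s_1|^2}{x_1}\Big).$$ Define $h:\mathscr H\to\mathscr H'$ by $h(X)(Y)=\frac13\frac{d}{ds}d(X+sY)|_{s=0}$ and $h'+\mathfrak h'$, with values in $\mathscr H=\operatorname{Hom}(\mathscr H',\mathbb R)$, by $(h'+\mathfrak h')(\xi)(\eta)=\frac13\frac{d}{ds}(d'+\mathfrak d')(\xi+s\eta)|_{s=0}$. Put $\mathscr H_\pm=\{X\in\mathscr H:\pm d(X)>0,\ y_1(h(X))\ne0\}$ and $\mathscr H'_+=\{\xi\in\mathscr H':(d'+\mathfrak d')(\xi)>0,\ y_1(\xi)\neq0\}$. Then $\mathscr H_\pm$ and $\mathscr H'_+$ are open, and each of the two maps $h:\mathscr H_\pm\to\mathscr H'_+$ is a diffeomorphism onto $\mathscr H'_+$, with inverse $$h^{-1}(\xi)=\pm\sqrt{\frac{27}{k\,k'}}\;\frac{1}{\sqrt{(d'+\mathfrak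 d')(\xi)}}\,(h'+\mathfrak h')(\xi),\qquad \xi\in\mathscr H'_+ .$$ In particular, if $d'+\mathfrak d'$ is scaled so that $kk'=27$, then $h^{-1}=\pm(d'+\mathfrak d')^{-1/2}\,(h'+\mathfrak h')$; for the scaling $kk'=1$ there is an additional factor $3\sqrt3$. -/

import Mathlib

open scoped ContDiff InnerProductSpace

set_option linter.unusedSectionVars false

noncomputable section

namespace SpecialVinberg

/-! ### Metric graded Clifford modules -/

/-- The quadratic form `v ↦ -⟨v, v⟩`; its Clifford algebra has the relation
`v * w + w * v = -2 ⟨v, w⟩`. -/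
def negForm (V : Type*) [NormedAddCommGroup V] [InnerProductSpace ℝ V] : QuadraticForm ℝ V :=
  -(LinearMap.BilinMap.toQuadraticMap (innerₗ V))

/-- A metric `ℤ/2`-graded module `S = S₀ + S₁` over the Clifford algebra of the Euclidean space
`V`: the summands are orthogonal and every Clifford multiplication by a vector is skew. -/
structure MetricCliffordModule (V S : Type*) [NormedAddCommGroup V] [InnerProductSpace ℝ V]
    [NormedAddCommGroup S] [InnerProductSpace ℝ S]
    [Module (CliffordAlgebra (negForm V)) S]
    [IsScalarTower ℝ (CliffordAlgebra (negForm V)) S] where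
  /-- the two homogeneous summands -/
  part : ZMod 2 → Submodule ℝ S
  isInternal : DirectSum.IsInternal part
  smul_mem : ∀ (i j : ZMod 2) (a : CliffordAlgebra (negForm V)) (s : S),
    a ∈ CliffordAlgebra.evenOdd (negForm V) i → s ∈ part j → a • s ∈ part (i + j)
  orthogonal : ∀ s₀ ∈ part 0, ∀ s₁ ∈ part 1, ⟪s₀, s₁⟫_ℝ = 0
  skew : ∀ (v : V) (s t : S),
    ⟪CliffordAlgebra.ι (negForm V) v • s, t⟫_ℝ = -⟪s, CliffordAlgebra.ι (negForm V) v • t⟫_ℝ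

/-! ### Polynomial and rational functions on a finite-dimensional real space -/

section Functions

variable {E : Type*} [NormedAddCommGroup E] [NormedSpace ℝ E]

/-- Polynomial functions: the algebra generated by the linear functionals. -/
def IsPolynomial (p : E → ℝ) : Prop :=
  p ∈ Algebra.adjoin ℝ (Set.range fun ℓ : StrongDual ℝ E => (ℓ : E → ℝ))

/-- A quotient of two polynomial functions with nonzero denominator. -/
structure RationalFunction (E : Type*) [NormedAddCommGroup E] [NormedSpace ℝ E] where
  num : E → ℝ
  den : E → ℝ
  num_poly : IsPolynomial num
  den_poly : IsPolynomial den
  den_ne : den ≠ 0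

/-- `r` is regular at `x` if it is a fraction `P / Q` of polynomials with `Q x ≠ 0`. -/
def RationalFunction.RegularAt (r : RationalFunction E) (x : E) : Prop :=
  ∃ PQ : (E → ℝ) × (E → ℝ), IsPolynomial PQ.1 ∧ IsPolynomial PQ.2 ∧
    r.num * PQ.2 = PQ.1 * r.den ∧ PQ.2 x ≠ 0

open Classical in
/-- The value of a rational function, `P x / Q x` for any fraction as in `RegularAt`
(and `0` off the domain of definition). -/
def RationalFunction.eval (r : RationalFunction E) (x : E) : ℝ :=
  if h : r.RegularAt x then h.choose.1 x / h.choose.2 x else 0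

variable [FiniteDimensional ℝ E]

/-- The canonical identification of `E` with its bidual. -/
def bidualEquiv (E : Type*) [NormedAddCommGroup E] [NormedSpace ℝ E] [FiniteDimensional ℝ E] :
    E ≃ₗ[ℝ] StrongDual ℝ (StrongDual ℝ E) :=
  (Module.evalEquiv ℝ E).trans
    ((LinearMap.toContinuousLinearMap (𝕜 := ℝ) (E := E) (F' := ℝ)).symm.dualMap.trans
      (LinearMap.toContinuousLinearMap (𝕜 := ℝ) (E := StrongDual ℝ E) (F' := ℝ)))

theorem bidualEquiv_apply (x : E) (ξ : StrongDual ℝ E) : bidualEquiv E x ξ = ξ x := rfl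

/-- The quadratic map of a cubic `d` on `E`: `h(X)(Y) = (1/3) d/ds d(X + sY)` at `s = 0`. -/
def quadraticMap (d : E → ℝ) (X : E) : StrongDual ℝ E := (1 / 3 : ℝ) • fderiv ℝ d X

/-- The quadratic map of a function `f` on the dual space, with values in `E`, identified with
the dual of its dual: `h'(ξ)(η) = (1/3) d/ds f(ξ + sη)` at `s = 0`. -/
def dualQuadraticMap (f : StrongDual ℝ E → ℝ) (ξ : StrongDual ℝ E) : E :=
  (bidualEquiv E).symm (quadraticMap f ξ)

end Functions

/-- `h` restricts to a diffeomorphism of the open set `U` onto the open set `U'`, with inverse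
`g`. -/
def IsDiffeoWithInverse {E F : Type*} [NormedAddCommGroup E] [NormedSpace ℝ E]
    [NormedAddCommGroup F] [NormedSpace ℝ F] (h : E → F) (g : F → E) (U : Set E) (U' : Set F) :
    Prop :=
  IsOpen U ∧ IsOpen U' ∧ Set.BijOn h U U' ∧ Set.InvOn g h U U' ∧
    ContDiffOn ℝ ∞ h U ∧ ContDiffOn ℝ ∞ g U'

/-! ### The special T-algebra -/

namespace MetricCliffordModule

variable {V S : Type*} [NormedAddCommGroup V] [InnerProductSpace ℝ V]
  [NormedAddCommGroup S] [InnerProductSpace ℝ S]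
  [Module (CliffordAlgebra (negForm V)) S] [IsScalarTower ℝ (CliffordAlgebra (negForm V)) S]
  (M : MetricCliffordModule V S)

/-- Clifford multiplication `μ : V × S₀ → S₁`. -/
def μ : V →ₗ[ℝ] M.part 0 →ₗ[ℝ] M.part 1 :=
  LinearMap.mk₂ ℝ
    (fun v s => ⟨CliffordAlgebra.ι (negForm V) v • (s : S), by
      simpa using M.smul_mem 1 0 _ _ (CliffordAlgebra.ι_mem_evenOdd_one _ v) s.2⟩)
    (fun v w s => by ext; simp [add_smul])
    (fun c v s => by ext; simp)
    (fun v s t => by ext; simp [smul_add])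
    (fun c v s => by
      ext
      exact (smul_algebra_smul_comm c (CliffordAlgebra.ι (negForm V) v) (s : S)))

variable [FiniteDimensional ℝ V] [FiniteDimensional ℝ S]

/-- The product `s₁ · v♭ ∈ S₀`, characterised by `⟨s₁ · v♭, s₀⟩ = ⟨μ(v, s₀), s₁⟩`. -/
def spinorDotCovector (s₁ : M.part 1) (v : V) : M.part 0 := LinearMap.adjoint (M.μ v) s₁

/-- The product `s₀♭ · s₁ ∈ V`, characterised by `⟨s₀♭ · s₁, v⟩ = ⟨μ(v, s₀), s₁⟩`. -/
def cospinorDotSpinor (s₀ : M.part 0) (s₁ : M.part 1) : V := LinearMap.adjoint (M.μ.flip s₀) s₁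

theorem spinorDotCovector_add (s t : M.part 1) (v w : V) :
    M.spinorDotCovector (s + t) v = M.spinorDotCovector s v + M.spinorDotCovector t v ∧
    M.spinorDotCovector s (v + w) = M.spinorDotCovector s v + M.spinorDotCovector s w := by
  simp [spinorDotCovector]

theorem spinorDotCovector_smul (c : ℝ) (s : M.part 1) (v : V) :
    M.spinorDotCovector (c • s) v = c • M.spinorDotCovector s v ∧
    M.spinorDotCovector s (c • v) = c • M.spinorDotCovector s v := by
  simp [spinorDotCovector]

theorem cospinorDotSpinor_add (s s' : M.part 0) (t t' : M.part 1) :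
    M.cospinorDotSpinor (s + s') t = M.cospinorDotSpinor s t + M.cospinorDotSpinor s' t ∧
    M.cospinorDotSpinor s (t + t') = M.cospinorDotSpinor s t + M.cospinorDotSpinor s t' := by
  simp [cospinorDotSpinor]

theorem cospinorDotSpinor_smul (c : ℝ) (s : M.part 0) (t : M.part 1) :
    M.cospinorDotSpinor (c • s) t = c • M.cospinorDotSpinor s t ∧
    M.cospinorDotSpinor s (c • t) = c • M.cospinorDotSpinor s t := by
  simp [cospinorDotSpinor]

/-- Elements of the special T-algebra, as `3 × 3` matrices
```
x₁   s₀  s₁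
t₀♭  x₂  v
t₁♭  w♭  x₃
```
An entry below the diagonal is a covector and is recorded by the vector metrically dual to it. -/
@[ext] structure TAlgebra (M : MetricCliffordModule V S) where
  x₁ : ℝ
  x₂ : ℝ
  x₃ : ℝ
  s₀ : M.part 0
  s₁ : M.part 1
  v : V
  t₀ : M.part 0
  t₁ : M.part 1
  w : V

namespace TAlgebra

variable {M}

instance : Add M.TAlgebra :=
  ⟨fun A B => ⟨A.x₁ + B.x₁, A.x₂ + B.x₂, A.x₃ + B.x₃, A.s₀ + B.s₀, A.s₁ + B.s₁, A.v + B.v,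
    A.t₀ + B.t₀, A.t₁ + B.t₁, A.w + B.w⟩⟩

instance : SMul ℝ M.TAlgebra :=
  ⟨fun c A => ⟨c * A.x₁, c * A.x₂, c * A.x₃, c • A.s₀, c • A.s₁, c • A.v,
    c • A.t₀, c • A.t₁, c • A.w⟩⟩

/-- The (non-associative) matrix product. The products of covectors are obtained from those of
vectors by the rule `a b = (b* a*)*`. -/
instance : Mul M.TAlgebra :=
  ⟨fun A B =>
    { x₁ := A.x₁ * B.x₁ + ⟪A.s₀, B.t₀⟫_ℝ + ⟪A.s₁, B.t₁⟫_ℝ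
      x₂ := ⟪A.t₀, B.s₀⟫_ℝ + A.x₂ * B.x₂ + ⟪A.v, B.w⟫_ℝ
      x₃ := ⟪A.t₁, B.s₁⟫_ℝ + ⟪A.w, B.v⟫_ℝ + A.x₃ * B.x₃
      s₀ := A.x₁ • B.s₀ + B.x₂ • A.s₀ + M.spinorDotCovector A.s₁ B.w
      s₁ := A.x₁ • B.s₁ + M.μ B.v A.s₀ + B.x₃ • A.s₁
      v := M.cospinorDotSpinor A.t₀ B.s₁ + A.x₂ • B.v + B.x₃ • A.v
      t₀ := B.x₁ • A.t₀ + A.x₂ • B.t₀ + M.spinorDotCovector B.t₁ A.v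
      t₁ := B.x₁ • A.t₁ + M.μ A.w B.t₀ + A.x₃ • B.t₁
      w := M.cospinorDotSpinor B.s₀ A.t₁ + B.x₂ • A.w + A.x₃ • B.w }⟩

/-- The involution of the T-algebra. -/
instance : Star M.TAlgebra :=
  ⟨fun A => ⟨A.x₁, A.x₂, A.x₃, A.t₀, A.t₁, A.w, A.s₀, A.s₁, A.v⟩⟩

theorem add_def (A B : M.TAlgebra) : A + B =
    ⟨A.x₁ + B.x₁, A.x₂ + B.x₂, A.x₃ + B.x₃, A.s₀ + B.s₀, A.s₁ + B.s₁, A.v + B.v,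
      A.t₀ + B.t₀, A.t₁ + B.t₁, A.w + B.w⟩ := rfl

theorem smul_def (c : ℝ) (A : M.TAlgebra) : c • A =
    ⟨c * A.x₁, c * A.x₂, c * A.x₃, c • A.s₀, c • A.s₁, c • A.v,
      c • A.t₀, c • A.t₁, c • A.w⟩ := rfl

theorem mul_def (A B : M.TAlgebra) : A * B =
    { x₁ := A.x₁ * B.x₁ + ⟪A.s₀, B.t₀⟫_ℝ + ⟪A.s₁, B.t₁⟫_ℝ
      x₂ := ⟪A.t₀, B.s₀⟫_ℝ + A.x₂ * B.x₂ + ⟪A.v, B.w⟫_ℝ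
      x₃ := ⟪A.t₁, B.s₁⟫_ℝ + ⟪A.w, B.v⟫_ℝ + A.x₃ * B.x₃
      s₀ := A.x₁ • B.s₀ + B.x₂ • A.s₀ + M.spinorDotCovector A.s₁ B.w
      s₁ := A.x₁ • B.s₁ + M.μ B.v A.s₀ + B.x₃ • A.s₁
      v := M.cospinorDotSpinor A.t₀ B.s₁ + A.x₂ • B.v + B.x₃ • A.v
      t₀ := B.x₁ • A.t₀ + A.x₂ • B.t₀ + M.spinorDotCovector B.t₁ A.v
      t₁ := B.x₁ • A.t₁ + M.μ A.w B.t₀ + A.x₃ • B.t₁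
      w := M.cospinorDotSpinor B.s₀ A.t₁ + B.x₂ • A.w + A.x₃ • B.w } := rfl

theorem star_def (A : M.TAlgebra) :
    star A = ⟨A.x₁, A.x₂, A.x₃, A.t₀, A.t₁, A.w, A.s₀, A.s₁, A.v⟩ := rfl

theorem mul_add' (A B C : M.TAlgebra) : A * (B + C) = A * B + A * C := by
  ext1 <;>
    simp only [add_def, mul_def, inner_add_right, map_add, LinearMap.add_apply,
      (M.spinorDotCovector_add _ _ _ 0).1, (M.spinorDotCovector_add _ 0 _ _).2,
      (M.cospinorDotSpinor_add _ _ _ 0).1, (M.cospinorDotSpinor_add _ 0 _ _).2] <;>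
    first | ring1 | module

theorem add_mul' (A B C : M.TAlgebra) : (A + B) * C = A * C + B * C := by
  ext1 <;>
    simp only [add_def, mul_def, inner_add_left, map_add, LinearMap.add_apply,
      (M.spinorDotCovector_add _ _ _ 0).1, (M.spinorDotCovector_add _ 0 _ _).2,
      (M.cospinorDotSpinor_add _ _ _ 0).1, (M.cospinorDotSpinor_add _ 0 _ _).2] <;>
    first | ring1 | module

theorem mul_smul' (c : ℝ) (A B : M.TAlgebra) : A * (c • B) = c • (A * B) := by
  ext1 <;>
    simp only [smul_def, mul_def, inner_smul_right, map_smul,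
      LinearMap.smul_apply, M.spinorDotCovector_smul, M.cospinorDotSpinor_smul] <;>
    first | ring1 | module

theorem smul_mul' (c : ℝ) (A B : M.TAlgebra) : (c • A) * B = c • (A * B) := by
  ext1 <;>
    simp only [smul_def, mul_def, real_inner_smul_left, map_smul,
      LinearMap.smul_apply, M.spinorDotCovector_smul, M.cospinorDotSpinor_smul] <;>
    first | ring1 | module

/-- The trace. -/
def tr (A : M.TAlgebra) : ℝ := A.x₁ + A.x₂ + A.x₃

/-- Upper triangular elements; they form the Lie algebra of the triangular group `G`, and those
of trace zero form the Lie algebra of its unimodular subgroup `G₀`. -/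
def IsUpper (A : M.TAlgebra) : Prop := A.t₀ = 0 ∧ A.t₁ = 0 ∧ A.w = 0

end TAlgebra

/-! ### Hermitian matrices and the action of the triangular group -/

/-- The space of Hermitian matrices, in the coordinates `(x₁, x₂, x₃, v, s₀, s₁)`. -/
def Herm (M : MetricCliffordModule V S) : Type _ :=
  ℝ × ℝ × ℝ × V × M.part 0 × M.part 1

instance : NormedAddCommGroup M.Herm :=
  inferInstanceAs (NormedAddCommGroup (ℝ × ℝ × ℝ × V × M.part 0 × M.part 1))

instance : NormedSpace ℝ M.Herm :=
  inferInstanceAs (NormedSpace ℝ (ℝ × ℝ × ℝ × V × M.part 0 × M.part 1))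

instance : FiniteDimensional ℝ M.Herm :=
  inferInstanceAs (FiniteDimensional ℝ (ℝ × ℝ × ℝ × V × M.part 0 × M.part 1))

/-- The matrix of a Hermitian element. -/
def toMat (X : M.Herm) : M.TAlgebra :=
  ⟨X.1, X.2.1, X.2.2.1, X.2.2.2.2.1, X.2.2.2.2.2, X.2.2.2.1,
    X.2.2.2.2.1, X.2.2.2.2.2, X.2.2.2.1⟩

/-- The upper triangular half of a matrix, as a Hermitian element. -/
def ofMat (A : M.TAlgebra) : M.Herm := (A.x₁, A.x₂, A.x₃, A.v, A.s₀, A.s₁)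

/-- The identity matrix. -/
def one : M.Herm := (1, 1, 1, 0, 0, 0)

/-- The first diagonal matrix unit. -/
def e₁ : M.Herm := (1, 0, 0, 0, 0, 0)

theorem toMat_add (X Y : M.Herm) : M.toMat (X + Y) = M.toMat X + M.toMat Y := rfl

theorem toMat_smul (c : ℝ) (X : M.Herm) : M.toMat (c • X) = c • M.toMat X := rfl

theorem ofMat_add (A B : M.TAlgebra) : M.ofMat (A + B) = M.ofMat A + M.ofMat B := rfl

theorem ofMat_smul (c : ℝ) (A : M.TAlgebra) : M.ofMat (c • A) = c • M.ofMat A := rfl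

/-- The infinitesimal action `T_B X = B X + X B*` on Hermitian matrices. -/
def T (B : M.TAlgebra) : M.Herm →L[ℝ] M.Herm :=
  LinearMap.toContinuousLinearMap
    { toFun := fun X => M.ofMat (B * M.toMat X + M.toMat X * star B)
      map_add' := fun X Y => by
        simp only [toMat_add, ofMat_add, TAlgebra.mul_add', TAlgebra.add_mul']
        abel
      map_smul' := fun c X => by
        simp only [toMat_smul, ofMat_add, ofMat_smul, TAlgebra.mul_smul', TAlgebra.smul_mul',
          RingHom.id_apply, smul_add] }

/-- `B X + X B*` is Hermitian. -/
theorem toMat_T (B : M.TAlgebra) (X : M.Herm) :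
    M.toMat (M.T B X) = B * M.toMat X + M.toMat X * star B := by
  have h : M.T B X = M.ofMat (B * M.toMat X + M.toMat X * star B) := rfl
  rw [h]
  ext1 <;>
    simp only [ofMat, toMat, TAlgebra.add_def, TAlgebra.mul_def, TAlgebra.star_def] <;>
    module

/-- The isomorphism `X ↦ X♭ = tr(X ·)` of the space of Hermitian matrices with its dual. -/
def flat (X : M.Herm) : StrongDual ℝ M.Herm :=
  LinearMap.toContinuousLinearMap
    { toFun := fun Y => (M.toMat X * M.toMat Y).tr
      map_add' := fun Y Z => by
        rw [toMat_add, TAlgebra.mul_add']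
        simp only [TAlgebra.tr, TAlgebra.add_def]
        ring
      map_smul' := fun c Y => by
        rw [toMat_smul, TAlgebra.mul_smul']
        simp only [TAlgebra.tr, TAlgebra.smul_def, RingHom.id_apply, smul_eq_mul]
        ring }

/-! ### Invariant cubics -/

/-- Invariant cubic polynomials on Hermitian matrices: `d(t A(X)) = t³ d(X)` for `t > 0` and
`A ∈ G₀`. The group `G₀` acts by the operators `exp(T_B)`, `B` upper triangular of trace zero. -/
def IsInvariantCubic (d : M.Herm → ℝ) : Prop :=
  IsPolynomial d ∧ d ≠ 0 ∧
    ∀ B : M.TAlgebra, B.IsUpper → B.tr = 0 → ∀ t : ℝ, 0 < t → ∀ X : M.Herm,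
      d (t • NormedSpace.exp (M.T B) X) = t ^ 3 * d X

/-- The dual action of `A = exp(T_B)` on functionals, `A'(ξ) = ξ ∘ A⁻¹`. -/
def dualAct (B : M.TAlgebra) (ξ : StrongDual ℝ M.Herm) : StrongDual ℝ M.Herm :=
  ξ.comp (NormedSpace.exp (-(M.T B)))

/-- Dual invariant cubic rational functions on the dual of the space of Hermitian matrices:
`r(t A'(ξ)) = t³ r(ξ)` for `t > 0` and `A ∈ G₀`, wherever both sides are defined. -/
def IsDualInvariantCubic (r : RationalFunction (StrongDual ℝ M.Herm)) : Prop :=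
  r.num ≠ 0 ∧
    ∀ B : M.TAlgebra, B.IsUpper → B.tr = 0 → ∀ t : ℝ, 0 < t → ∀ ξ : StrongDual ℝ M.Herm,
      r.RegularAt ξ → r.RegularAt (t • M.dualAct B ξ) →
        r.eval (t • M.dualAct B ξ) = t ^ 3 * r.eval ξ

/-- The cubic form
`x₁x₂x₃ - x₁|v|² - x₂|s₁|² - x₃|s₀|² + 2⟨μ(v, s₀), s₁⟩`. -/
def cubic (X : M.Herm) : ℝ :=
  let A := M.toMat X
  A.x₁ * A.x₂ * A.x₃ - A.x₁ * ‖A.v‖ ^ 2 - A.x₂ * ‖A.s₁‖ ^ 2 - A.x₃ * ‖A.s₀‖ ^ 2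
    + 2 * ⟪M.μ A.v A.s₀, A.s₁⟫_ℝ

/-- The rational function `cubic + (|s₀|²|s₁|² - |s₀♭ · s₁|²) / x₁`. -/
def dualCubic (X : M.Herm) : ℝ :=
  let A := M.toMat X
  M.cubic X + (‖A.s₀‖ ^ 2 * ‖A.s₁‖ ^ 2 - ‖M.cospinorDotSpinor A.s₀ A.s₁‖ ^ 2) / A.x₁

/-- The coordinate `y₁` on the dual space. -/
def y₁ (ξ : StrongDual ℝ M.Herm) : ℝ := ξ M.e₁

/-- The set `{d > 0, y₁ ∘ h ≠ 0}`. -/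
def Hpos (d : M.Herm → ℝ) : Set M.Herm := {X | 0 < d X ∧ M.y₁ (quadraticMap d X) ≠ 0}

/-- The set `{d < 0, y₁ ∘ h ≠ 0}`. -/
def Hneg (d : M.Herm → ℝ) : Set M.Herm := {X | d X < 0 ∧ M.y₁ (quadraticMap d X) ≠ 0}

/-- The set `{r > 0, y₁ ≠ 0}` in the dual space. -/
def Hpos' (r : RationalFunction (StrongDual ℝ M.Herm)) : Set (StrongDual ℝ M.Herm) :=
  {ξ | 0 < r.eval ξ ∧ M.y₁ ξ ≠ 0}

end MetricCliffordModule

end SpecialVinberg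

end

open SpecialVinberg

open scoped ContDiff InnerProductSpace

set_option linter.unusedSectionVars false
set_option linter.unusedSimpArgs false

noncomputable section

namespace SpecialVinberg

/-! ### Polynomial functions -/

section Polynomials

variable {E F : Type*} [NormedAddCommGroup E] [NormedSpace ℝ E]
  [NormedAddCommGroup F] [NormedSpace ℝ F]

/-! Invariance under triangular groups leaves only one candidate for each cubic, up to a factor.
Elimination starting from the entry `x₃` writes every Hermitian matrix near the identity as three
unipotent operators applied to a positive diagonal matrix, itself `t • exp` of a diagonal generator
applied to the identity (`exp_upper`, `exists_diag`). The multiplier `t ^ 3` is the product of the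
pivots, and that product is `cubic`. So `d` and `d(I) · cubic` agree near `I`, hence everywhere by
analyticity (`eq_cubic_of_isInvariantCubic`).

On the dual side the trace form makes `T_B` and `T_{B*}` transposes of each other (`flat_T`), so the
dual action becomes that of lower triangular operators on Hermitian matrices (`dualAct_flat`).
Elimination now starts from `x₁`, and the product of pivots is `dualCubic` (`exp_lower`). The two
products differ by `(|s₀|²|s₁|² - |s₀♭ · s₁|²) / x₁`, since Cauchy-Schwarz type equalities of
ordinary matrices can fail here.

For the inversion, let `adj` and `dualAdj` be the gradients of the two cubics for the trace form.
The identities `dualAdj (adj X) = cubic X • X` and `adj (dualAdj X) = dualCubic X • X` make them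
inverse up to scalars, while `dualCubic (adj X) = cubic X ^ 2` and `cubic (dualAdj X) = dualCubic X
^ 2` identify these scalars up to sign. Dividing by the square root of the dual cubic therefore
inverts `h` on each sign of `d`; the factors `k / 3` and `k' / 3` combine to `√(27 / (k k'))`. All
four identities are Schur complement computations resting on one Clifford fact: multiplication by
`v` is `|v|` times an isometry (`inner_μ_μ_self`, `μ_spinorDotCovector_self`). -/

theorem IsPolynomial.analyticOnNhd {p : E → ℝ} (hp : IsPolynomial p) :
    AnalyticOnNhd ℝ p Set.univ := by
  refine Algebra.adjoin_induction (p := fun p _ => AnalyticOnNhd ℝ p Set.univ)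
    ?_ ?_ ?_ ?_ hp
  · rintro _ ⟨ℓ, rfl⟩
    exact ℓ.analyticOnNhd _
  · intro c
    exact analyticOnNhd_const
  · intro _ _ _ _ h h'
    exact h.add h'
  · intro _ _ _ _ h h'
    exact h.mul h'

theorem IsPolynomial.add {p q : E → ℝ} (hp : IsPolynomial p) (hq : IsPolynomial q) :
    IsPolynomial (fun x => p x + q x) := Subalgebra.add_mem _ hp hq

theorem IsPolynomial.sub {p q : E → ℝ} (hp : IsPolynomial p) (hq : IsPolynomial q) :
    IsPolynomial (fun x => p x - q x) := Subalgebra.sub_mem _ hp hq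

theorem IsPolynomial.mul {p q : E → ℝ} (hp : IsPolynomial p) (hq : IsPolynomial q) :
    IsPolynomial (fun x => p x * q x) := Subalgebra.mul_mem _ hp hq

theorem isPolynomial_const (c : ℝ) : IsPolynomial (fun _ : E => c) :=
  Subalgebra.algebraMap_mem _ c

theorem IsPolynomial.pow {p : E → ℝ} (hp : IsPolynomial p) (n : ℕ) :
    IsPolynomial (fun x => p x ^ n) := Subalgebra.pow_mem _ hp n

theorem isPolynomial_sum {ι : Type*} [Fintype ι] {p : ι → E → ℝ} (hp : ∀ i, IsPolynomial (p i)) :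
    IsPolynomial (fun x => ∑ i, p i x) := by
  have h := Subalgebra.sum_mem (Algebra.adjoin ℝ (Set.range fun ℓ : StrongDual ℝ E => (ℓ : E → ℝ)))
    (t := Finset.univ) (fun i _ => hp i)
  unfold IsPolynomial
  convert h using 1
  ext x
  simp

theorem isPolynomial_clm (ℓ : StrongDual ℝ E) : IsPolynomial (fun x => ℓ x) :=
  Algebra.subset_adjoin ⟨ℓ, rfl⟩

theorem isPolynomial_inner {W : Type*} [NormedAddCommGroup W] [InnerProductSpace ℝ W]
    [FiniteDimensional ℝ W] (f g : E →L[ℝ] W) : IsPolynomial (fun x => ⟪f x, g x⟫_ℝ) := by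
  have h : (fun x => ⟪f x, g x⟫_ℝ) = fun x => ∑ i,
      ((innerSL ℝ (stdOrthonormalBasis ℝ W i)).comp f x) *
        ((innerSL ℝ (stdOrthonormalBasis ℝ W i)).comp g x) := by
    ext x
    rw [← (stdOrthonormalBasis ℝ W).sum_inner_mul_inner (f x) (g x)]
    refine Finset.sum_congr rfl fun i _ => ?_
    simp [real_inner_comm]
  rw [h]
  exact isPolynomial_sum fun i => (isPolynomial_clm _).mul (isPolynomial_clm _)

theorem isPolynomial_norm_sq {W : Type*} [NormedAddCommGroup W] [InnerProductSpace ℝ W]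
    [FiniteDimensional ℝ W] (f : E →L[ℝ] W) : IsPolynomial (fun x => ‖f x‖ ^ 2) := by
  simpa using isPolynomial_inner f f

theorem IsPolynomial.comp_clm {p : F → ℝ} (hp : IsPolynomial p) (f : E →L[ℝ] F) :
    IsPolynomial (fun x => p (f x)) := by
  refine Algebra.adjoin_induction (p := fun p _ => IsPolynomial (fun x => p (f x)))
    ?_ ?_ ?_ ?_ hp
  · rintro _ ⟨ℓ, rfl⟩
    exact isPolynomial_clm (ℓ.comp f)
  · intro c
    exact isPolynomial_const c
  · intro _ _ _ _ h h'
    exact h.add h'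
  · intro _ _ _ _ h h'
    exact h.mul h'

/-- Where `p` is nonzero it stays nonzero nearby, so `q` vanishes on an open set and hence
identically. This is the cancellation law behind every manipulation of fractions below. -/
theorem eq_zero_or_eq_zero_of_analytic {p q : E → ℝ} (hp : AnalyticOnNhd ℝ p Set.univ)
    (hq : AnalyticOnNhd ℝ q Set.univ) (h : ∀ x, p x * q x = 0) : p = 0 ∨ q = 0 := by
  by_contra! hne
  obtain ⟨x, hx⟩ := Function.ne_iff.1 hne.1
  refine hne.2 (hq.eq_of_eventuallyEq (g := 0) analyticOnNhd_const (z₀ := x) ?_)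
  filter_upwards [(hp x trivial).continuousAt.eventually_ne hx] with y hy
  exact (mul_eq_zero.1 (h y)).resolve_left hy

/-- Relative invariance of the fraction `p / q` under `g`, with multiplier `c`. -/
def IsSemiinvariant (p q : E → ℝ) (g : E →L[ℝ] E) (c : ℝ) : Prop :=
  ∀ x, p (g x) * q x = c * (p x * q (g x))

theorem IsSemiinvariant.comp {p q : E → ℝ} {g g' : E →L[ℝ] E} {c c' : ℝ}
    (hp : AnalyticOnNhd ℝ p Set.univ) (hq : AnalyticOnNhd ℝ q Set.univ) (hq0 : q ≠ 0)
    (h : IsSemiinvariant p q g c) (h' : IsSemiinvariant p q g' c')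
    (hg : Function.Surjective g) : IsSemiinvariant p q (g'.comp g) (c' * c) := by
  have an (f : E → ℝ) (hf : AnalyticOnNhd ℝ f Set.univ) (L : E →L[ℝ] E) :
      AnalyticOnNhd ℝ (fun x => f (L x)) Set.univ :=
    hf.comp (L.analyticOnNhd _) fun _ _ => trivial
  -- Chaining the two relations produces the extra factor `q (g x)`, which may vanish at some
  -- points; it is cancelled as a function, being nonzero because `g` is surjective.
  have key : ∀ x, q (g x) * (p ((g'.comp g) x) * q x - c' * c * (p x * q ((g'.comp g) x))) = 0 := by
    intro x
    have h1 := h x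
    have h2 := h' (g x)
    simp only [ContinuousLinearMap.comp_apply] at h1 h2 ⊢
    linear_combination q x * h2 + c' * q (g' (g x)) * h1
  rcases eq_zero_or_eq_zero_of_analytic (an q hq g)
    (((an p hp (g'.comp g)).mul hq).sub
      (analyticOnNhd_const.mul (hp.mul (an q hq (g'.comp g))))) key with h0 | h0
  · refine absurd ?_ hq0
    ext x
    obtain ⟨y, rfl⟩ := hg x
    exact congrFun h0 y
  · intro x
    exact sub_eq_zero.1 (congrFun h0 x)

/-- A relation of fractions that holds off the zeros of the denominators holds everywhere. -/
theorem isSemiinvariant_of_ne {p q m : E → ℝ} {g : E →L[ℝ] E} {c : ℝ}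
    (hp : AnalyticOnNhd ℝ p Set.univ) (hq : AnalyticOnNhd ℝ q Set.univ)
    (hm : AnalyticOnNhd ℝ m Set.univ) (hm0 : m ≠ 0) (hg : Function.Surjective g)
    (h : ∀ x, m x ≠ 0 → m (g x) ≠ 0 → p (g x) * q x = c * (p x * q (g x))) :
    IsSemiinvariant p q g c := by
  have an (f : E → ℝ) (hf : AnalyticOnNhd ℝ f Set.univ) :
      AnalyticOnNhd ℝ (fun x => f (g x)) Set.univ :=
    hf.comp (g.analyticOnNhd _) fun _ _ => trivial
  rcases eq_zero_or_eq_zero_of_analytic (hm.mul (an m hm))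
    (((an p hp).mul hq).sub (analyticOnNhd_const (v := c) |>.mul (hp.mul (an q hq))))
    (fun x => by
      by_cases h1 : m x = 0
      · simp [h1]
      by_cases h2 : m (g x) = 0
      · simp [h2]
      simp [h x h1 h2]) with h0 | h0
  · rcases eq_zero_or_eq_zero_of_analytic hm (an m hm) (fun x => congrFun h0 x) with h1 | h1
    · exact absurd h1 hm0
    · refine absurd ?_ hm0
      ext x
      obtain ⟨y, rfl⟩ := hg x
      exact congrFun h1 y
  · intro x
    exact sub_eq_zero.1 (congrFun h0 x)

/-- `eval` uses an arbitrarily chosen fraction. Two fractions representing `r` have equal cross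
products after multiplication by `r.den`, which can be cancelled. -/
theorem RationalFunction.eval_eq (r : RationalFunction E) {P Q : E → ℝ} (hP : IsPolynomial P)
    (hQ : IsPolynomial Q) (h : r.num * Q = P * r.den) {x : E} (hx : Q x ≠ 0) :
    r.RegularAt x ∧ r.eval x = P x / Q x := by
  have hreg : r.RegularAt x := ⟨(P, Q), hP, hQ, h, hx⟩
  refine ⟨hreg, ?_⟩
  rw [RationalFunction.eval, dif_pos hreg]
  obtain ⟨h1, h2, h3, h4⟩ := hreg.choose_spec
  set P' := hreg.choose.1
  set Q' := hreg.choose.2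
  rw [div_eq_div_iff h4 hx]
  rcases eq_zero_or_eq_zero_of_analytic r.den_poly.analyticOnNhd
    ((h1.mul hQ).sub (hP.mul h2)).analyticOnNhd (fun y => by
      have e := congrFun h y
      have e' := congrFun h3 y
      simp only [Pi.mul_apply] at e e'
      linear_combination Q' y * e - Q y * e') with h0 | h0
  · exact absurd h0 r.den_ne
  · exact sub_eq_zero.1 (congrFun h0 x)

end Polynomials

/-! ### Exponentials of endomorphisms -/

section Exponentials

variable {E : Type*} [NormedAddCommGroup E] [NormedSpace ℝ E] [CompleteSpace E]

theorem hasSum_exp_apply (T : E →L[ℝ] E) (x : E) :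
    HasSum (fun n : ℕ => ((n.factorial : ℝ)⁻¹) • (T ^ n) x) (NormedSpace.exp T x) := by
  have h := NormedSpace.exp_series_hasSum_exp' (𝕂 := ℝ) T
  exact h.mapL (ContinuousLinearMap.apply ℝ E x)

/-- The factor 2 in `h'` absorbs the coefficient `1 / 2!` of the series. Only the orbit of `x` has
to terminate; `T` itself need not be nilpotent. -/
theorem exp_apply_of_nilpotent (T : E →L[ℝ] E) {x y z : E} (h : T x = y)
    (h' : T y = (2 : ℝ) • z) (h'' : T z = 0) : NormedSpace.exp T x = x + y + z := by
  refine (hasSum_exp_apply T x).unique ?_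
  have hz : ∀ n, (T ^ (n + 3)) x = 0 := by
    intro n
    rw [pow_add, mul_apply_eq_comp]
    simp [pow_succ, h, h', h'']
  have hs := hasSum_sum_of_ne_finset_zero (L := SummationFilter.unconditional ℕ)
    (f := fun n : ℕ => ((n.factorial : ℝ)⁻¹) • (T ^ n) x) (s := Finset.range 3) (by
      intro n hn
      obtain ⟨m, rfl⟩ := Nat.exists_eq_add_of_le' (not_lt.1 (mt Finset.mem_range.2 hn))
      simp [hz])
  convert hs using 1
  simp [Finset.sum_range_succ, h, h', smul_smul]

theorem exp_apply_of_eigenvector (T : E →L[ℝ] E) {x : E} {c : ℝ} (h : T x = c • x) :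
    NormedSpace.exp T x = Real.exp c • x := by
  have hn : ∀ n, (T ^ n) x = c ^ n • x := by
    intro n
    induction n with
    | zero => simp
    | succ n ih => rw [pow_succ, mul_apply_eq_comp, h, map_smul, ih, smul_smul, pow_succ']
  refine (hasSum_exp_apply T x).unique ?_
  have := (NormedSpace.exp_series_hasSum_exp' (𝕂 := ℝ) c).smul_const x
  rw [Real.exp_eq_exp_ℝ]
  simpa [hn, smul_smul] using this

/-- Exponentials of transposed operators are transposed. -/
theorem exp_transpose {F : Type*} [NormedAddCommGroup F] [NormedSpace ℝ F] [CompleteSpace F]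
    (b : E →L[ℝ] StrongDual ℝ F) (L : E →L[ℝ] E) (T : F →L[ℝ] F)
    (h : ∀ x y, b (L x) y = b x (T y)) (x : E) (y : F) :
    b (NormedSpace.exp L x) y = b x (NormedSpace.exp T y) := by
  have hn : ∀ n x y, b ((L ^ n) x) y = b x ((T ^ n) y) := by
    intro n
    induction n with
    | zero => simp
    | succ n ih =>
      intro x y
      rw [pow_succ', pow_succ]
      simp only [mul_apply_eq_comp]
      rw [h, ih]
  have h1 := ((hasSum_exp_apply L x).mapL b).mapL (ContinuousLinearMap.apply ℝ ℝ y)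
  have h2 := (hasSum_exp_apply T y).mapL (b x)
  have e : (fun n : ℕ => (ContinuousLinearMap.apply ℝ ℝ y) (b (((n.factorial : ℝ)⁻¹) • (L ^ n) x)))
      = fun n : ℕ => b x (((n.factorial : ℝ)⁻¹) • (T ^ n) y) := by
    ext n
    rw [map_smul, map_smul, map_smul]
    exact congrArg _ (hn n x y)
  rw [e] at h1
  exact h1.unique h2

theorem surjective_exp (T : E →L[ℝ] E) :
    Function.Surjective (NormedSpace.exp T : E →L[ℝ] E) := by
  intro x
  -- `NormedSpace.isUnit_exp` is applied over a rational normed algebra, obtained by restricting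
  -- scalars.
  let _ : NormedAlgebra ℚ (E →L[ℝ] E) := NormedAlgebra.restrictScalars ℚ ℝ _
  obtain ⟨u, hu⟩ := NormedSpace.isUnit_exp T
  refine ⟨(↑u⁻¹ : E →L[ℝ] E) x, ?_⟩
  rw [← hu, ← mul_apply_eq_comp, u.mul_inv]
  rfl

end Exponentials

namespace MetricCliffordModule

variable {V S : Type*} [NormedAddCommGroup V] [InnerProductSpace ℝ V]
  [NormedAddCommGroup S] [InnerProductSpace ℝ S]
  [Module (CliffordAlgebra (negForm V)) S] [IsScalarTower ℝ (CliffordAlgebra (negForm V)) S]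
  (M : MetricCliffordModule V S) [FiniteDimensional ℝ V] [FiniteDimensional ℝ S]

/-! ### Identities for Clifford multiplication -/

theorem inner_spinorDotCovector (s₁ : M.part 1) (v : V) (s₀ : M.part 0) :
    ⟪M.spinorDotCovector s₁ v, s₀⟫_ℝ = ⟪M.μ v s₀, s₁⟫_ℝ := by
  rw [spinorDotCovector, LinearMap.adjoint_inner_left, real_inner_comm]

theorem inner_cospinorDotSpinor (s₀ : M.part 0) (s₁ : M.part 1) (v : V) :
    ⟪M.cospinorDotSpinor s₀ s₁, v⟫_ℝ = ⟪M.μ v s₀, s₁⟫_ℝ := by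
  rw [cospinorDotSpinor, LinearMap.adjoint_inner_left, real_inner_comm, LinearMap.flip_apply]

theorem coe_μ (v : V) (s : M.part 0) : (M.μ v s : S) = CliffordAlgebra.ι (negForm V) v • (s : S) :=
  rfl

theorem ι_smul_ι_smul (v : V) (s : S) :
    CliffordAlgebra.ι (negForm V) v • CliffordAlgebra.ι (negForm V) v • s = -(‖v‖ ^ 2 • s) := by
  rw [← mul_smul, CliffordAlgebra.ι_sq_scalar, algebraMap_smul]
  simp [negForm]

/-- Skewness moves one factor `v` across the scalar product, where `v² = -|v|²` applies. -/
theorem inner_μ_μ_self (v : V) (s t : M.part 0) :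
    ⟪M.μ v s, M.μ v t⟫_ℝ = ‖v‖ ^ 2 * ⟪s, t⟫_ℝ := by
  rw [Submodule.coe_inner, coe_μ, coe_μ, M.skew, ι_smul_ι_smul, inner_neg_right, neg_neg,
    real_inner_smul_right, Submodule.coe_inner]

theorem spinorDotCovector_μ_self (v : V) (s : M.part 0) :
    M.spinorDotCovector (M.μ v s) v = ‖v‖ ^ 2 • s := by
  refine ext_inner_right ℝ fun t => ?_
  rw [inner_spinorDotCovector, inner_μ_μ_self, real_inner_smul_left, real_inner_comm]

/-- By skewness the adjoint of `μ v` is minus Clifford multiplication on the odd part. This gives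
the identity for `μ v` after its adjoint, which the isometry property alone would not. -/
theorem coe_spinorDotCovector (s : M.part 1) (v : V) :
    (M.spinorDotCovector s v : S) = -(CliffordAlgebra.ι (negForm V) v • (s : S)) := by
  have hmem : CliffordAlgebra.ι (negForm V) v • (s : S) ∈ M.part 0 := by
    have h11 : (1 + 1 : ZMod 2) = 0 := rfl
    have := M.smul_mem 1 1 _ _ (CliffordAlgebra.ι_mem_evenOdd_one _ v) s.2
    rwa [h11] at this
  have h : M.spinorDotCovector s v = -⟨_, hmem⟩ := by
    refine ext_inner_right ℝ fun t => ?_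
    rw [inner_spinorDotCovector, Submodule.coe_inner, Submodule.coe_inner, coe_μ, real_inner_comm,
      Submodule.coe_neg, inner_neg_left, M.skew, neg_neg]
  rw [h]
  rfl

theorem μ_spinorDotCovector_self (s : M.part 1) (v : V) :
    M.μ v (M.spinorDotCovector s v) = ‖v‖ ^ 2 • s := by
  ext
  rw [coe_μ, coe_spinorDotCovector, smul_neg, ι_smul_ι_smul, neg_neg]
  rfl

theorem spinorDotCovector_add_left (s t : M.part 1) (v : V) :
    M.spinorDotCovector (s + t) v = M.spinorDotCovector s v + M.spinorDotCovector t v :=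
  (M.spinorDotCovector_add s t v 0).1

theorem spinorDotCovector_add_right (s : M.part 1) (v w : V) :
    M.spinorDotCovector s (v + w) = M.spinorDotCovector s v + M.spinorDotCovector s w :=
  (M.spinorDotCovector_add s 0 v w).2

theorem spinorDotCovector_smul_left (c : ℝ) (s : M.part 1) (v : V) :
    M.spinorDotCovector (c • s) v = c • M.spinorDotCovector s v :=
  (M.spinorDotCovector_smul c s v).1

theorem spinorDotCovector_smul_right (c : ℝ) (s : M.part 1) (v : V) :
    M.spinorDotCovector s (c • v) = c • M.spinorDotCovector s v :=
  (M.spinorDotCovector_smul c s v).2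

theorem cospinorDotSpinor_add_left (s s' : M.part 0) (t : M.part 1) :
    M.cospinorDotSpinor (s + s') t = M.cospinorDotSpinor s t + M.cospinorDotSpinor s' t :=
  (M.cospinorDotSpinor_add s s' t 0).1

theorem cospinorDotSpinor_add_right (s : M.part 0) (t t' : M.part 1) :
    M.cospinorDotSpinor s (t + t') = M.cospinorDotSpinor s t + M.cospinorDotSpinor s t' :=
  (M.cospinorDotSpinor_add s 0 t t').2

theorem cospinorDotSpinor_smul_left (c : ℝ) (s : M.part 0) (t : M.part 1) :
    M.cospinorDotSpinor (c • s) t = c • M.cospinorDotSpinor s t :=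
  (M.cospinorDotSpinor_smul c s t).1

theorem cospinorDotSpinor_smul_right (c : ℝ) (s : M.part 0) (t : M.part 1) :
    M.cospinorDotSpinor s (c • t) = c • M.cospinorDotSpinor s t :=
  (M.cospinorDotSpinor_smul c s t).2

theorem spinorDotCovector_zero_left (v : V) : M.spinorDotCovector 0 v = 0 := by
  simp [spinorDotCovector]

theorem spinorDotCovector_zero_right (s : M.part 1) : M.spinorDotCovector s 0 = 0 := by
  simp [spinorDotCovector]

theorem cospinorDotSpinor_zero_left (s : M.part 1) : M.cospinorDotSpinor 0 s = 0 := by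
  simp [cospinorDotSpinor]

theorem cospinorDotSpinor_zero_right (s : M.part 0) : M.cospinorDotSpinor s 0 = 0 := by
  simp [cospinorDotSpinor]

/-! ### Norms of Clifford products and their polarisations -/

theorem norm_μ_sq (v : V) (s : M.part 0) : ‖M.μ v s‖ ^ 2 = ‖v‖ ^ 2 * ‖s‖ ^ 2 := by
  rw [← real_inner_self_eq_norm_sq, inner_μ_μ_self, real_inner_self_eq_norm_sq]

theorem norm_spinorDotCovector_sq (s : M.part 1) (v : V) :
    ‖M.spinorDotCovector s v‖ ^ 2 = ‖v‖ ^ 2 * ‖s‖ ^ 2 := by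
  rw [← real_inner_self_eq_norm_sq, inner_spinorDotCovector, μ_spinorDotCovector_self,
    real_inner_smul_left, real_inner_self_eq_norm_sq]

theorem μ_spinorDotCovector_add_swap (s : M.part 1) (v w : V) :
    M.μ v (M.spinorDotCovector s w) + M.μ w (M.spinorDotCovector s v) = (2 * ⟪v, w⟫_ℝ) • s := by
  have h := M.μ_spinorDotCovector_self s (v + w)
  rw [spinorDotCovector_add_right, norm_add_sq_real] at h
  simp only [map_add, LinearMap.add_apply, μ_spinorDotCovector_self] at h
  linear_combination (norm := module) h

theorem inner_μ_μ_same (v w : V) (s : M.part 0) :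
    ⟪M.μ v s, M.μ w s⟫_ℝ = ⟪v, w⟫_ℝ * ‖s‖ ^ 2 := by
  have h := M.norm_μ_sq (v + w) s
  rw [map_add, LinearMap.add_apply, norm_add_sq_real, norm_add_sq_real, norm_μ_sq, norm_μ_sq] at h
  linear_combination h / 2

theorem inner_spinorDotCovector_same (v w : V) (s : M.part 1) :
    ⟪M.spinorDotCovector s v, M.spinorDotCovector s w⟫_ℝ = ⟪v, w⟫_ℝ * ‖s‖ ^ 2 := by
  have h := M.norm_spinorDotCovector_sq s (v + w)
  rw [spinorDotCovector_add_right, norm_add_sq_real, norm_add_sq_real,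
    norm_spinorDotCovector_sq, norm_spinorDotCovector_sq] at h
  linear_combination h / 2

theorem cospinorDotSpinor_μ (s : M.part 0) (w : V) :
    M.cospinorDotSpinor s (M.μ w s) = ‖s‖ ^ 2 • w := by
  refine ext_inner_right ℝ fun v => ?_
  rw [inner_cospinorDotSpinor, inner_μ_μ_same, real_inner_smul_left, real_inner_comm, mul_comm]

theorem cospinorDotSpinor_spinorDotCovector (s : M.part 1) (w : V) :
    M.cospinorDotSpinor (M.spinorDotCovector s w) s = ‖s‖ ^ 2 • w := by
  refine ext_inner_right ℝ fun v => ?_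
  rw [inner_cospinorDotSpinor, ← inner_spinorDotCovector, inner_spinorDotCovector_same,
    real_inner_smul_left, real_inner_comm, mul_comm]

/-- The polarised Clifford relation moves `v` past the test vector `w`. For `v ≠ 0` the right side
is `-|v|²` times the reflection of `s₀♭ · s₁` in the hyperplane orthogonal to `v`. -/
theorem cospinorDotSpinor_spinorDotCovector_μ (s : M.part 0) (t : M.part 1) (v : V) :
    M.cospinorDotSpinor (M.spinorDotCovector t v) (M.μ v s) =
      (2 * ⟪v, M.cospinorDotSpinor s t⟫_ℝ) • v - ‖v‖ ^ 2 • M.cospinorDotSpinor s t := by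
  refine ext_inner_right ℝ fun w => ?_
  rw [inner_cospinorDotSpinor, eq_sub_of_add_eq (M.μ_spinorDotCovector_add_swap t w v),
    inner_sub_left, inner_sub_left, real_inner_smul_left, real_inner_smul_left,
    real_inner_smul_left, inner_μ_μ_self, inner_spinorDotCovector, inner_cospinorDotSpinor,
    real_inner_comm (M.cospinorDotSpinor s t) v, inner_cospinorDotSpinor,
    real_inner_comm (M.μ v s) t, real_inner_comm w v]
  ring

/-- The product of the spinor components of the adjugate of a Hermitian matrix. -/
theorem cospinorDotSpinor_adj (a b : ℝ) (v : V) (s : M.part 0) (t : M.part 1) :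
    M.cospinorDotSpinor (M.spinorDotCovector t v - a • s) (M.μ v s - b • t) =
      (a * b - ‖v‖ ^ 2) • M.cospinorDotSpinor s t +
        (2 * ⟪v, M.cospinorDotSpinor s t⟫_ℝ - a * ‖s‖ ^ 2 - b * ‖t‖ ^ 2) • v := by
  have e1 : M.spinorDotCovector t v - a • s = M.spinorDotCovector t v + (-a) • s := by module
  have e2 : M.μ v s - b • t = M.μ v s + (-b) • t := by module
  rw [e1, e2]
  simp only [cospinorDotSpinor_add_left, cospinorDotSpinor_add_right, cospinorDotSpinor_smul_left,
    cospinorDotSpinor_smul_right, cospinorDotSpinor_spinorDotCovector_μ, cospinorDotSpinor_μ,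
    cospinorDotSpinor_spinorDotCovector]
  module

theorem norm_spinorDotCovector_sub_sq (a : ℝ) (v : V) (s : M.part 0) (t : M.part 1) :
    ‖M.spinorDotCovector t v - a • s‖ ^ 2 =
      ‖v‖ ^ 2 * ‖t‖ ^ 2 - 2 * a * ⟪v, M.cospinorDotSpinor s t⟫_ℝ + a ^ 2 * ‖s‖ ^ 2 := by
  rw [norm_sub_sq_real, norm_spinorDotCovector_sq, real_inner_smul_right, inner_spinorDotCovector,
    ← inner_cospinorDotSpinor, norm_smul, mul_pow, Real.norm_eq_abs, sq_abs, real_inner_comm v]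
  ring

theorem norm_μ_sub_sq (a : ℝ) (v : V) (s : M.part 0) (t : M.part 1) :
    ‖M.μ v s - a • t‖ ^ 2 =
      ‖v‖ ^ 2 * ‖s‖ ^ 2 - 2 * a * ⟪v, M.cospinorDotSpinor s t⟫_ℝ + a ^ 2 * ‖t‖ ^ 2 := by
  rw [norm_sub_sq_real, norm_μ_sq, real_inner_smul_right,
    ← inner_cospinorDotSpinor, norm_smul, mul_pow, Real.norm_eq_abs, sq_abs, real_inner_comm v]
  ring

/-! ### Adjugates -/

variable {M} in
theorem herm_ext {X Y : M.Herm} (h₁ : (M.toMat X).x₁ = (M.toMat Y).x₁)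
    (h₂ : (M.toMat X).x₂ = (M.toMat Y).x₂) (h₃ : (M.toMat X).x₃ = (M.toMat Y).x₃)
    (h₄ : (M.toMat X).v = (M.toMat Y).v) (h₅ : (M.toMat X).s₀ = (M.toMat Y).s₀)
    (h₆ : (M.toMat X).s₁ = (M.toMat Y).s₁) : X = Y :=
  Prod.ext h₁ (Prod.ext h₂ (Prod.ext h₃ (Prod.ext h₄ (Prod.ext h₅ h₆))))

/-- The adjugate: the gradient of the cubic form with respect to the trace form. -/
def adj (X : M.Herm) : M.Herm :=
  let A := M.toMat X
  (A.x₂ * A.x₃ - ‖A.v‖ ^ 2, A.x₁ * A.x₃ - ‖A.s₁‖ ^ 2, A.x₁ * A.x₂ - ‖A.s₀‖ ^ 2,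
    M.cospinorDotSpinor A.s₀ A.s₁ - A.x₁ • A.v,
    M.spinorDotCovector A.s₁ A.v - A.x₃ • A.s₀, M.μ A.v A.s₀ - A.x₂ • A.s₁)

/-- The reduced entry `x₂ - |s₀|² / x₁`. -/
def red₂ (X : M.Herm) : ℝ := (M.toMat X).x₂ - ‖(M.toMat X).s₀‖ ^ 2 / (M.toMat X).x₁

/-- The reduced entry `x₃ - |s₁|² / x₁`. -/
def red₃ (X : M.Herm) : ℝ := (M.toMat X).x₃ - ‖(M.toMat X).s₁‖ ^ 2 / (M.toMat X).x₁

/-- The reduced entry `v - s₀♭ · s₁ / x₁`. -/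
def redV (X : M.Herm) : V :=
  (M.toMat X).v - (M.toMat X).x₁⁻¹ • M.cospinorDotSpinor (M.toMat X).s₀ (M.toMat X).s₁

/-- The gradient of the dual cubic with respect to the trace form. -/
def dualAdj (X : M.Herm) : M.Herm :=
  let A := M.toMat X
  let p := M.red₂ X
  let q := M.red₃ X
  let u := M.redV X
  (p * q - ‖u‖ ^ 2 + (p * ‖A.s₁‖ ^ 2 + q * ‖A.s₀‖ ^ 2
      - 2 * ⟪u, M.cospinorDotSpinor A.s₀ A.s₁⟫_ℝ) / A.x₁,
    A.x₁ * q, A.x₁ * p, -(A.x₁ • u),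
    M.spinorDotCovector A.s₁ u - q • A.s₀, M.μ u A.s₀ - p • A.s₁)

theorem cubic_def (X : M.Herm) : M.cubic X =
    (M.toMat X).x₁ * ((M.toMat X).x₂ * (M.toMat X).x₃ - ‖(M.toMat X).v‖ ^ 2)
      - (M.toMat X).x₂ * ‖(M.toMat X).s₁‖ ^ 2 - (M.toMat X).x₃ * ‖(M.toMat X).s₀‖ ^ 2
      + 2 * ⟪(M.toMat X).v, M.cospinorDotSpinor (M.toMat X).s₀ (M.toMat X).s₁⟫_ℝ := by
  rw [real_inner_comm, inner_cospinorDotSpinor, cubic]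
  ring

theorem norm_redV_sq (X : M.Herm) : ‖M.redV X‖ ^ 2 = ‖(M.toMat X).v‖ ^ 2
    - 2 * ⟪(M.toMat X).v, M.cospinorDotSpinor (M.toMat X).s₀ (M.toMat X).s₁⟫_ℝ / (M.toMat X).x₁
    + ‖M.cospinorDotSpinor (M.toMat X).s₀ (M.toMat X).s₁‖ ^ 2 / (M.toMat X).x₁ ^ 2 := by
  rw [redV, norm_sub_sq_real, norm_smul, mul_pow, real_inner_smul_right, norm_inv, inv_pow,
    Real.norm_eq_abs, sq_abs]
  ring

/-- The reduced entries form the Schur complement of `x₁`. Its 2 × 2 determinant contains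
`|s₀|²|s₁|² / x₁²` from the diagonal and `|s₀♭ · s₁|² / x₁²` from `redV`; their difference is the
correction term. -/
theorem dualCubic_eq (X : M.Herm) (hX : (M.toMat X).x₁ ≠ 0) :
    M.dualCubic X = (M.toMat X).x₁ * (M.red₂ X * M.red₃ X - ‖M.redV X‖ ^ 2) := by
  rw [norm_redV_sq, dualCubic, cubic_def, red₂, red₃]
  field_simp
  ring

theorem adj_dualAdj (X : M.Herm) (hX : (M.toMat X).x₁ ≠ 0) :
    M.adj (M.dualAdj X) = M.dualCubic X • X := by
  rw [M.dualCubic_eq X hX]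
  -- `dualAdj` is written in reduced entries, so the target entries of `X` are rewritten in them
  -- too.
  have h2 : (M.toMat X).x₂ = M.red₂ X + ‖(M.toMat X).s₀‖ ^ 2 / (M.toMat X).x₁ := by
    rw [red₂]; ring
  have h3 : (M.toMat X).x₃ = M.red₃ X + ‖(M.toMat X).s₁‖ ^ 2 / (M.toMat X).x₁ := by
    rw [red₃]; ring
  have hv : (M.toMat X).v = M.redV X
      + (M.toMat X).x₁⁻¹ • M.cospinorDotSpinor (M.toMat X).s₀ (M.toMat X).s₁ := by
    rw [redV]; module
  refine herm_ext ?_ ?_ ?_ ?_ ?_ ?_ <;>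
    simp only [toMat_smul, TAlgebra.smul_def]
  · simp only [adj, dualAdj, toMat, norm_neg, norm_smul, mul_pow, Real.norm_eq_abs, sq_abs]
    ring
  · rw [h2]
    simp only [adj, dualAdj, toMat]
    rw [norm_μ_sub_sq]
    simp only [toMat] at hX
    field_simp
    ring
  · rw [h3]
    simp only [adj, dualAdj, toMat]
    rw [norm_spinorDotCovector_sub_sq]
    simp only [toMat] at hX
    field_simp
    ring
  · rw [hv]
    simp only [adj, dualAdj, toMat] at hX ⊢
    rw [cospinorDotSpinor_adj]
    match_scalars <;> field_simp
    ring
  · simp only [adj, dualAdj, toMat]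
    rw [← neg_smul, spinorDotCovector_smul_right, sub_eq_add_neg (M.μ _ _), ← neg_smul,
      spinorDotCovector_add_left, spinorDotCovector_smul_left, spinorDotCovector_μ_self]
    module
  · simp only [adj, dualAdj, toMat]
    rw [← neg_smul, map_smul, LinearMap.smul_apply, map_sub, map_smul, μ_spinorDotCovector_self]
    module

/-- As for ordinary matrices, the Schur complement in the adjugate is a multiple of the 2 × 2
adjugate of the complementary block `(x₂, v; v♭, x₃)`. Together with `red₃_adj` and `redV_adj` this
describes it completely. -/
theorem red₂_adj (X : M.Herm) (hX : (M.toMat (M.adj X)).x₁ ≠ 0) :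
    M.red₂ (M.adj X) = (M.toMat X).x₃ * M.cubic X / (M.toMat (M.adj X)).x₁ := by
  rw [red₂, cubic_def, eq_div_iff hX, sub_mul, div_mul_cancel₀ _ hX]
  simp only [adj, toMat]
  rw [norm_spinorDotCovector_sub_sq]
  ring

theorem red₃_adj (X : M.Herm) (hX : (M.toMat (M.adj X)).x₁ ≠ 0) :
    M.red₃ (M.adj X) = (M.toMat X).x₂ * M.cubic X / (M.toMat (M.adj X)).x₁ := by
  rw [red₃, cubic_def, eq_div_iff hX, sub_mul, div_mul_cancel₀ _ hX]
  simp only [adj, toMat]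
  rw [norm_μ_sub_sq]
  ring

theorem cospinorDotSpinor_adj_eq (X : M.Herm) :
    M.cospinorDotSpinor (M.toMat (M.adj X)).s₀ (M.toMat (M.adj X)).s₁ =
      (M.toMat (M.adj X)).x₁ • M.cospinorDotSpinor (M.toMat X).s₀ (M.toMat X).s₁ +
        (M.cubic X - (M.toMat X).x₁ * (M.toMat (M.adj X)).x₁) • (M.toMat X).v := by
  rw [cubic_def]
  simp only [adj, toMat]
  rw [cospinorDotSpinor_adj]
  module

theorem redV_adj (X : M.Herm) (hX : (M.toMat (M.adj X)).x₁ ≠ 0) :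
    M.redV (M.adj X) = (-(M.cubic X / (M.toMat (M.adj X)).x₁)) • (M.toMat X).v := by
  rw [redV, cospinorDotSpinor_adj_eq, smul_add, smul_smul, inv_mul_cancel₀ hX]
  have : (M.toMat (M.adj X)).v = M.cospinorDotSpinor (M.toMat X).s₀ (M.toMat X).s₁
    - (M.toMat X).x₁ • (M.toMat X).v := rfl
  rw [this]
  match_scalars
  · ring
  · field_simp
    ring

/-- After substituting the Schur complement of `adj X`, only the Clifford identities and the
expansion of `cubic` along `q = x₂x₃ - |v|²` remain. The condition `q ≠ 0` is what `y₁ ∘ h ≠ 0`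
provides. -/
theorem dualAdj_adj (X : M.Herm) (hX : (M.toMat (M.adj X)).x₁ ≠ 0) :
    M.dualAdj (M.adj X) = M.cubic X • X := by
  have hq : (M.toMat (M.adj X)).x₁ = (M.toMat X).x₂ * (M.toMat X).x₃ - ‖(M.toMat X).v‖ ^ 2 := rfl
  have h0 : (M.toMat (M.adj X)).s₀ = M.spinorDotCovector (M.toMat X).s₁ (M.toMat X).v
      - (M.toMat X).x₃ • (M.toMat X).s₀ := rfl
  have h1 : (M.toMat (M.adj X)).s₁ = M.μ (M.toMat X).v (M.toMat X).s₀
      - (M.toMat X).x₂ • (M.toMat X).s₁ := rfl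
  have hd := M.cubic_def X
  rw [← hq] at hd
  have e2 := M.red₂_adj X hX
  have e3 := M.red₃_adj X hX
  have ev := M.redV_adj X hX
  have ec := M.cospinorDotSpinor_adj_eq X
  have n0 := congrArg (fun s => ‖s‖ ^ 2) h0
  have n1 := congrArg (fun s => ‖s‖ ^ 2) h1
  simp only [norm_spinorDotCovector_sub_sq, norm_μ_sub_sq] at n0 n1
  set q := (M.toMat (M.adj X)).x₁
  set D := M.cubic X
  refine herm_ext ?_ ?_ ?_ ?_ ?_ ?_ <;>
    rw [toMat_smul, TAlgebra.smul_def]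
  · change M.red₂ (M.adj X) * M.red₃ (M.adj X) - ‖M.redV (M.adj X)‖ ^ 2 +
      (M.red₂ (M.adj X) * ‖(M.toMat (M.adj X)).s₁‖ ^ 2
        + M.red₃ (M.adj X) * ‖(M.toMat (M.adj X)).s₀‖ ^ 2 - 2 * ⟪M.redV (M.adj X),
        M.cospinorDotSpinor (M.toMat (M.adj X)).s₀ (M.toMat (M.adj X)).s₁⟫_ℝ) / q = _
    rw [e2, e3, ev, ec, n0, n1, norm_smul, mul_pow, real_inner_smul_left, inner_add_right,
      real_inner_smul_right, real_inner_smul_right, real_inner_self_eq_norm_sq, Real.norm_eq_abs,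
      sq_abs]
    field_simp
    rw [hd, hq]
    ring
  · change q * M.red₃ (M.adj X) = _
    rw [e3]
    field_simp
  · change q * M.red₂ (M.adj X) = _
    rw [e2]
    field_simp
  · change -(q • M.redV (M.adj X)) = _
    rw [ev, smul_smul, ← neg_smul]
    congr 1
    field_simp
  · change M.spinorDotCovector (M.toMat (M.adj X)).s₁ (M.redV (M.adj X))
      - M.red₃ (M.adj X) • (M.toMat (M.adj X)).s₀ = _
    rw [e3, ev, h0, h1, spinorDotCovector_smul_right, sub_eq_add_neg (M.μ _ _), ← neg_smul,
      spinorDotCovector_add_left, spinorDotCovector_smul_left, spinorDotCovector_μ_self]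
    match_scalars
    · field_simp
      rw [hq]
      ring
    · field_simp
      ring
  · change M.μ (M.redV (M.adj X)) (M.toMat (M.adj X)).s₀
      - M.red₂ (M.adj X) • (M.toMat (M.adj X)).s₁ = _
    rw [e2, ev, h0, h1, map_smul, LinearMap.smul_apply, map_sub, map_smul,
      μ_spinorDotCovector_self]
    match_scalars
    · field_simp
      rw [hq]
      ring
    · field_simp
      ring

/-! ### The trace form -/

theorem flat_apply (X Y : M.Herm) : M.flat X Y =
    (M.toMat X).x₁ * (M.toMat Y).x₁ + (M.toMat X).x₂ * (M.toMat Y).x₂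
      + (M.toMat X).x₃ * (M.toMat Y).x₃ + 2 * ⟪(M.toMat X).s₀, (M.toMat Y).s₀⟫_ℝ
      + 2 * ⟪(M.toMat X).s₁, (M.toMat Y).s₁⟫_ℝ + 2 * ⟪(M.toMat X).v, (M.toMat Y).v⟫_ℝ := by
  have h : M.flat X Y = (M.toMat X * M.toMat Y).tr := rfl
  rw [h]
  simp only [TAlgebra.tr, TAlgebra.mul_def, toMat]
  ring

theorem toMat_zero : M.toMat 0 = ⟨0, 0, 0, 0, 0, 0, 0, 0, 0⟩ := rfl

theorem flat_self_eq_zero {X : M.Herm} (h : M.flat X X = 0) : X = 0 := by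
  rw [flat_apply] at h
  simp only [real_inner_self_eq_norm_sq] at h
  have p₁ := mul_self_nonneg (M.toMat X).x₁
  have p₂ := mul_self_nonneg (M.toMat X).x₂
  have p₃ := mul_self_nonneg (M.toMat X).x₃
  have p₄ := sq_nonneg ‖(M.toMat X).s₀‖
  have p₅ := sq_nonneg ‖(M.toMat X).s₁‖
  have p₆ := sq_nonneg ‖(M.toMat X).v‖
  refine herm_ext ?_ ?_ ?_ ?_ ?_ ?_ <;> rw [toMat_zero]
  · exact mul_self_eq_zero.1 (by linarith)
  · exact mul_self_eq_zero.1 (by linarith)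
  · exact mul_self_eq_zero.1 (by linarith)
  all_goals
    exact norm_eq_zero.1 ((pow_eq_zero_iff two_ne_zero).1 (by linarith))

/-- The trace form, as a linear map to the dual. -/
def flatₗ : M.Herm →ₗ[ℝ] StrongDual ℝ M.Herm where
  toFun := M.flat
  map_add' X Y := by
    ext Z
    simp only [_root_.add_apply, flat_apply, toMat_add, TAlgebra.add_def,
      inner_add_left]
    ring
  map_smul' c X := by
    ext Z
    simp only [_root_.smul_apply, flat_apply, toMat_smul, TAlgebra.smul_def,
      real_inner_smul_left, RingHom.id_apply, smul_eq_mul]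
    ring

theorem finrank_strongDual {E : Type*} [NormedAddCommGroup E] [NormedSpace ℝ E]
    [FiniteDimensional ℝ E] : Module.finrank ℝ E = Module.finrank ℝ (StrongDual ℝ E) := by
  rw [← (LinearMap.toContinuousLinearMap (𝕜 := ℝ) (E := E) (F' := ℝ)).finrank_eq]
  exact (Subspace.dual_finrank_eq (K := ℝ) (V := E)).symm

/-- The trace form, as an isomorphism with the dual. -/
def flatEquiv : M.Herm ≃L[ℝ] StrongDual ℝ M.Herm :=
  (LinearEquiv.ofInjectiveOfFinrankEq M.flatₗ (by
    rw [← LinearMap.ker_eq_bot, LinearMap.ker_eq_bot']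
    intro X hX
    exact M.flat_self_eq_zero (DFunLike.congr_fun hX X)) finrank_strongDual).toContinuousLinearEquiv

theorem flatEquiv_apply (X : M.Herm) : M.flatEquiv X = M.flat X := rfl

/-- Both sides expand into scalar products of entries and values of the single trilinear form `⟨μ(v,
s₀), s₁⟩`; associativity of the matrix product plays no role. -/
theorem flat_T (L : M.TAlgebra) (X Y : M.Herm) :
    M.flat (M.T L X) Y = M.flat X (M.T (star L) Y) := by
  simp only [flat_apply, toMat_T, TAlgebra.add_def, TAlgebra.mul_def, TAlgebra.star_def]
  simp only [toMat, inner_add_left, inner_add_right, real_inner_smul_left, real_inner_smul_right,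
    inner_spinorDotCovector, inner_cospinorDotSpinor, real_inner_comm (M.spinorDotCovector _ _),
    real_inner_comm (M.cospinorDotSpinor _ _)]
  simp only [real_inner_comm]
  ring

theorem T_apply (B : M.TAlgebra) (X : M.Herm) :
    M.T B X = M.ofMat (B * M.toMat X + M.toMat X * star B) := rfl

theorem T_neg_star (L : M.TAlgebra) : M.T ((-1 : ℝ) • star L) = -M.T (star L) := by
  have h : star ((-1 : ℝ) • star L) = (-1 : ℝ) • star (star L) := rfl
  ext X : 1
  have h' : (-M.T (star L)) X = (-1 : ℝ) • M.T (star L) X := (neg_one_smul ℝ _).symm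
  rw [h', T_apply, T_apply, h, TAlgebra.smul_mul', TAlgebra.mul_smul', ofMat_add, ofMat_smul,
    ofMat_smul, ofMat_add, smul_add]

/-- Since `A'` composes with `A⁻¹`, the generator is `-L*`: it is upper triangular exactly when `L`
is lower triangular. Dual invariance thus becomes lower triangular invariance. -/
theorem dualAct_flat (L : M.TAlgebra) (X : M.Herm) :
    M.dualAct ((-1 : ℝ) • star L) (M.flat X) = M.flat (NormedSpace.exp (M.T L) X) := by
  ext Y
  have := FiniteDimensional.complete ℝ M.Herm
  have h := exp_transpose (M.flatEquiv : M.Herm →L[ℝ] StrongDual ℝ M.Herm) (M.T L) (M.T (star L))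
    (fun X Y => M.flat_T L X Y) X Y
  rw [dualAct, T_neg_star, neg_neg]
  exact h.symm

/-! ### One-parameter subgroups of the triangular groups -/

/-- The Hermitian matrix with the given entries. -/
def herm (x₁ x₂ x₃ : ℝ) (v : V) (s₀ : M.part 0) (s₁ : M.part 1) : M.Herm := (x₁, x₂, x₃, v, s₀, s₁)

theorem toMat_herm (x₁ x₂ x₃ : ℝ) (v : V) (s₀ : M.part 0) (s₁ : M.part 1) :
    M.toMat (M.herm x₁ x₂ x₃ v s₀ s₁) = ⟨x₁, x₂, x₃, s₀, s₁, v, s₀, s₁, v⟩ := rfl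

theorem herm_toMat (X : M.Herm) : M.herm (M.toMat X).x₁ (M.toMat X).x₂ (M.toMat X).x₃ (M.toMat X).v
    (M.toMat X).s₀ (M.toMat X).s₁ = X := rfl

theorem one_eq_herm : M.one = M.herm 1 1 1 0 0 0 := rfl

theorem herm_add (x₁ x₂ x₃ y₁ y₂ y₃ : ℝ) (v w : V) (s₀ t₀ : M.part 0) (s₁ t₁ : M.part 1) :
    M.herm x₁ x₂ x₃ v s₀ s₁ + M.herm y₁ y₂ y₃ w t₀ t₁ =
      M.herm (x₁ + y₁) (x₂ + y₂) (x₃ + y₃) (v + w) (s₀ + t₀) (s₁ + t₁) := rfl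

theorem herm_zero : M.herm 0 0 0 0 0 0 = 0 := rfl

theorem T_upper (a : M.part 0) (b : M.part 1) (c : V) (x₁ x₂ x₃ : ℝ) (v : V) (s₀ : M.part 0)
    (s₁ : M.part 1) : M.T ⟨0, 0, 0, a, b, c, 0, 0, 0⟩ (M.herm x₁ x₂ x₃ v s₀ s₁) =
      M.herm (2 * ⟪a, s₀⟫_ℝ + 2 * ⟪b, s₁⟫_ℝ) (2 * ⟪c, v⟫_ℝ) 0 (x₃ • c)
        (x₂ • a + M.spinorDotCovector b v + M.spinorDotCovector s₁ c) (M.μ v a + x₃ • b) := by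
  refine herm_ext ?_ ?_ ?_ ?_ ?_ ?_ <;>
    simp only [toMat_T, toMat_herm, TAlgebra.mul_def, TAlgebra.add_def, TAlgebra.star_def,
      inner_zero_left, inner_zero_right, real_inner_comm a, real_inner_comm b, real_inner_comm c,
      cospinorDotSpinor_zero_left, cospinorDotSpinor_zero_right, map_zero, LinearMap.zero_apply,
      zero_mul, mul_zero, zero_smul, smul_zero, zero_add, add_zero]
  all_goals ring

theorem T_lower (a : M.part 0) (b : M.part 1) (c : V) (x₁ x₂ x₃ : ℝ) (v : V) (s₀ : M.part 0)
    (s₁ : M.part 1) : M.T ⟨0, 0, 0, 0, 0, 0, a, b, c⟩ (M.herm x₁ x₂ x₃ v s₀ s₁) =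
      M.herm 0 (2 * ⟪a, s₀⟫_ℝ) (2 * ⟪b, s₁⟫_ℝ + 2 * ⟪c, v⟫_ℝ)
        (M.cospinorDotSpinor a s₁ + M.cospinorDotSpinor s₀ b + x₂ • c) (x₁ • a)
        (x₁ • b + M.μ c s₀) := by
  refine herm_ext ?_ ?_ ?_ ?_ ?_ ?_ <;>
    simp only [toMat_T, toMat_herm, TAlgebra.mul_def, TAlgebra.add_def, TAlgebra.star_def,
      inner_zero_left, inner_zero_right, real_inner_comm a, real_inner_comm b, real_inner_comm c,
      spinorDotCovector_zero_left, spinorDotCovector_zero_right, map_zero, LinearMap.zero_apply,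
      zero_mul, mul_zero, zero_smul, smul_zero, zero_add, add_zero]
  · ring
  · ring
  · module

/-- A generator with one off-diagonal entry acts like an elementary row and column operation: its
square reaches only the diagonal and its cube vanishes, so the exponential is quadratic. -/
theorem exp_T_herm {B : M.TAlgebra} {x₁ x₂ x₃ z₁ z₂ z₃ : ℝ} {v : V} {s₀ : M.part 0} {s₁ : M.part 1}
    {Y : M.Herm} (h : M.T B (M.herm x₁ x₂ x₃ v s₀ s₁) = Y)
    (h' : M.T B Y = M.herm (2 * z₁) (2 * z₂) (2 * z₃) 0 0 0)
    (h'' : M.T B (M.herm z₁ z₂ z₃ 0 0 0) = 0) :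
    NormedSpace.exp (M.T B) (M.herm x₁ x₂ x₃ v s₀ s₁) =
      M.herm x₁ x₂ x₃ v s₀ s₁ + Y + M.herm z₁ z₂ z₃ 0 0 0 := by
  have := FiniteDimensional.complete ℝ M.Herm
  refine exp_apply_of_nilpotent (M.T B) h (h'.trans ?_) h''
  refine herm_ext ?_ ?_ ?_ ?_ ?_ ?_ <;> simp [toMat_herm, toMat_smul, TAlgebra.smul_def]

theorem exp_T_s₀ (a : M.part 0) (x₁ x₂ x₃ : ℝ) (v : V) (s₀ : M.part 0) (s₁ : M.part 1) :
    NormedSpace.exp (M.T ⟨0, 0, 0, a, 0, 0, 0, 0, 0⟩) (M.herm x₁ x₂ x₃ v s₀ s₁) =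
      M.herm (x₁ + 2 * ⟪a, s₀⟫_ℝ + x₂ * ‖a‖ ^ 2) x₂ x₃ v (s₀ + x₂ • a) (s₁ + M.μ v a) := by
  rw [M.exp_T_herm (z₁ := x₂ * ‖a‖ ^ 2) (z₂ := 0) (z₃ := 0)
    (Y := M.herm (2 * ⟪a, s₀⟫_ℝ) 0 0 0 (x₂ • a) (M.μ v a))]
  all_goals simp only [T_upper, herm_add, spinorDotCovector_zero_left, spinorDotCovector_zero_right,
    real_inner_smul_right, real_inner_self_eq_norm_sq, inner_zero_left, inner_zero_right, smul_zero,
    zero_smul, mul_zero, add_zero, zero_add, map_zero, LinearMap.zero_apply, herm_zero]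

theorem exp_T_s₁ (b : M.part 1) (x₁ x₂ x₃ : ℝ) (v : V) (s₀ : M.part 0) (s₁ : M.part 1) :
    NormedSpace.exp (M.T ⟨0, 0, 0, 0, b, 0, 0, 0, 0⟩) (M.herm x₁ x₂ x₃ v s₀ s₁) =
      M.herm (x₁ + 2 * ⟪b, s₁⟫_ℝ + x₃ * ‖b‖ ^ 2) x₂ x₃ v (s₀ + M.spinorDotCovector b v)
        (s₁ + x₃ • b) := by
  rw [M.exp_T_herm (z₁ := x₃ * ‖b‖ ^ 2) (z₂ := 0) (z₃ := 0)
    (Y := M.herm (2 * ⟪b, s₁⟫_ℝ) 0 0 0 (M.spinorDotCovector b v) (x₃ • b))]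
  all_goals simp only [T_upper, herm_add, spinorDotCovector_zero_left, spinorDotCovector_zero_right,
    real_inner_smul_right, real_inner_self_eq_norm_sq, inner_zero_left, inner_zero_right, smul_zero,
    zero_smul, mul_zero, add_zero, zero_add, map_zero, LinearMap.zero_apply, herm_zero]

theorem exp_T_v (c : V) (x₁ x₂ x₃ : ℝ) (v : V) (s₀ : M.part 0) (s₁ : M.part 1) :
    NormedSpace.exp (M.T ⟨0, 0, 0, 0, 0, c, 0, 0, 0⟩) (M.herm x₁ x₂ x₃ v s₀ s₁) =
      M.herm x₁ (x₂ + 2 * ⟪c, v⟫_ℝ + x₃ * ‖c‖ ^ 2) x₃ (v + x₃ • c) (s₀ + M.spinorDotCovector s₁ c)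
        s₁ := by
  rw [M.exp_T_herm (z₁ := 0) (z₂ := x₃ * ‖c‖ ^ 2) (z₃ := 0)
    (Y := M.herm 0 (2 * ⟪c, v⟫_ℝ) 0 (x₃ • c) (M.spinorDotCovector s₁ c) 0)]
  all_goals simp only [T_upper, herm_add, spinorDotCovector_zero_left, spinorDotCovector_zero_right,
    real_inner_smul_right, real_inner_self_eq_norm_sq, inner_zero_left, inner_zero_right, smul_zero,
    zero_smul, mul_zero, add_zero, zero_add, map_zero, LinearMap.zero_apply, herm_zero]

theorem exp_T_t₀ (a : M.part 0) (x₁ x₂ x₃ : ℝ) (v : V) (s₀ : M.part 0) (s₁ : M.part 1) :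
    NormedSpace.exp (M.T ⟨0, 0, 0, 0, 0, 0, a, 0, 0⟩) (M.herm x₁ x₂ x₃ v s₀ s₁) =
      M.herm x₁ (x₂ + 2 * ⟪a, s₀⟫_ℝ + x₁ * ‖a‖ ^ 2) x₃ (v + M.cospinorDotSpinor a s₁)
        (s₀ + x₁ • a) s₁ := by
  rw [M.exp_T_herm (z₁ := 0) (z₂ := x₁ * ‖a‖ ^ 2) (z₃ := 0)
    (Y := M.herm 0 (2 * ⟪a, s₀⟫_ℝ) 0 (M.cospinorDotSpinor a s₁) (x₁ • a) 0)]
  all_goals simp only [T_lower, herm_add, cospinorDotSpinor_zero_left, cospinorDotSpinor_zero_right,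
    real_inner_smul_right, real_inner_self_eq_norm_sq, inner_zero_left, inner_zero_right, smul_zero,
    zero_smul, mul_zero, add_zero, zero_add, map_zero, LinearMap.zero_apply, herm_zero]

theorem exp_T_t₁ (b : M.part 1) (x₁ x₂ x₃ : ℝ) (v : V) (s₀ : M.part 0) (s₁ : M.part 1) :
    NormedSpace.exp (M.T ⟨0, 0, 0, 0, 0, 0, 0, b, 0⟩) (M.herm x₁ x₂ x₃ v s₀ s₁) =
      M.herm x₁ x₂ (x₃ + 2 * ⟪b, s₁⟫_ℝ + x₁ * ‖b‖ ^ 2) (v + M.cospinorDotSpinor s₀ b) s₀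
        (s₁ + x₁ • b) := by
  rw [M.exp_T_herm (z₁ := 0) (z₂ := 0) (z₃ := x₁ * ‖b‖ ^ 2)
    (Y := M.herm 0 0 (2 * ⟪b, s₁⟫_ℝ) (M.cospinorDotSpinor s₀ b) 0 (x₁ • b))]
  all_goals simp only [T_lower, herm_add, cospinorDotSpinor_zero_left, cospinorDotSpinor_zero_right,
    real_inner_smul_right, real_inner_self_eq_norm_sq, inner_zero_left, inner_zero_right, smul_zero,
    zero_smul, mul_zero, add_zero, zero_add, map_zero, LinearMap.zero_apply, herm_zero]

theorem exp_T_w (c : V) (x₁ x₂ x₃ : ℝ) (v : V) (s₀ : M.part 0) (s₁ : M.part 1) :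
    NormedSpace.exp (M.T ⟨0, 0, 0, 0, 0, 0, 0, 0, c⟩) (M.herm x₁ x₂ x₃ v s₀ s₁) =
      M.herm x₁ x₂ (x₃ + 2 * ⟪c, v⟫_ℝ + x₂ * ‖c‖ ^ 2) (v + x₂ • c) s₀ (s₁ + M.μ c s₀) := by
  rw [M.exp_T_herm (z₁ := 0) (z₂ := 0) (z₃ := x₂ * ‖c‖ ^ 2)
    (Y := M.herm 0 0 (2 * ⟪c, v⟫_ℝ) (x₂ • c) 0 (M.μ c s₀))]
  all_goals simp only [T_lower, herm_add, cospinorDotSpinor_zero_left, cospinorDotSpinor_zero_right,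
    real_inner_smul_right, real_inner_self_eq_norm_sq, inner_zero_left, inner_zero_right, smul_zero,
    zero_smul, mul_zero, add_zero, zero_add, map_zero, LinearMap.zero_apply, herm_zero]

theorem exp_T_diag (b₁ b₂ b₃ : ℝ) :
    NormedSpace.exp (M.T ⟨b₁, b₂, b₃, 0, 0, 0, 0, 0, 0⟩) M.one =
      M.herm (Real.exp (2 * b₁)) (Real.exp (2 * b₂)) (Real.exp (2 * b₃)) 0 0 0 := by
  have := FiniteDimensional.complete ℝ M.Herm
  have h : M.one = M.herm 1 0 0 0 0 0 + M.herm 0 1 0 0 0 0 + M.herm 0 0 1 0 0 0 := by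
    refine herm_ext ?_ ?_ ?_ ?_ ?_ ?_ <;>
      simp [one_eq_herm, toMat_herm, toMat_add, TAlgebra.add_def]
  rw [h, map_add, map_add, exp_apply_of_eigenvector (x := M.herm 1 0 0 0 0 0) (c := 2 * b₁),
    exp_apply_of_eigenvector (x := M.herm 0 1 0 0 0 0) (c := 2 * b₂),
    exp_apply_of_eigenvector (x := M.herm 0 0 1 0 0 0) (c := 2 * b₃)]
  all_goals
    refine herm_ext ?_ ?_ ?_ ?_ ?_ ?_ <;>
      simp [toMat_T, toMat_herm, toMat_add, toMat_smul, TAlgebra.smul_def, TAlgebra.mul_def,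
        TAlgebra.add_def, TAlgebra.star_def, spinorDotCovector_zero_left,
        spinorDotCovector_zero_right, cospinorDotSpinor_zero_left, cospinorDotSpinor_zero_right]
  all_goals ring

/-! ### Orbits of the identity matrix -/

theorem exists_diag {y₁ y₂ y₃ : ℝ} (h₁ : 0 < y₁) (h₂ : 0 < y₂) (h₃ : 0 < y₃) :
    ∃ t b₁ b₂ b₃ : ℝ, 0 < t ∧ t ^ 3 = y₁ * y₂ * y₃ ∧ b₁ + b₂ + b₃ = 0 ∧
      (t • NormedSpace.exp (M.T ⟨b₁, b₂, b₃, 0, 0, 0, 0, 0, 0⟩)) M.one = M.herm y₁ y₂ y₃ 0 0 0 := by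
  have hp : 0 < y₁ * y₂ * y₃ := by positivity
  -- Trace zero forces `t` to be the geometric mean of the entries. The exponents `log (yᵢ / t) / 2`
  -- carry a half because a diagonal generator acts on both sides of the matrix.
  set t := (y₁ * y₂ * y₃) ^ (1 / 3 : ℝ) with ht
  have ht0 : 0 < t := Real.rpow_pos_of_pos hp _
  have ht3 : t ^ 3 = y₁ * y₂ * y₃ := by
    rw [ht, ← Real.rpow_natCast, ← Real.rpow_mul hp.le]
    norm_num
  have he : ∀ y : ℝ, 0 < y → t * Real.exp (2 * (Real.log (y / t) / 2)) = y := by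
    intro y hy
    rw [mul_div_cancel₀ _ two_ne_zero, Real.exp_log (by positivity)]
    field_simp
  refine ⟨t, Real.log (y₁ / t) / 2, Real.log (y₂ / t) / 2, Real.log (y₃ / t) / 2, ht0, ht3, ?_, ?_⟩
  · have := congrArg Real.log ht3
    rw [Real.log_pow, Real.log_mul (by positivity) h₃.ne', Real.log_mul h₁.ne' h₂.ne'] at this
    rw [Real.log_div h₁.ne' ht0.ne', Real.log_div h₂.ne' ht0.ne', Real.log_div h₃.ne' ht0.ne']
    push_cast at this
    linarith
  · rw [_root_.smul_apply, exp_T_diag]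
    refine herm_ext ?_ ?_ ?_ ?_ ?_ ?_ <;>
      simp [toMat_smul, toMat_herm, TAlgebra.smul_def, he, h₁, h₂, h₃]

/-- A positive matrix in terms of the action of the upper triangular group. -/
theorem exp_upper {x₁ x₂ x₃ : ℝ} {v : V} {s₀ : M.part 0} {s₁ : M.part 1} (h₃ : x₃ ≠ 0) {y₂ : ℝ}
    (hy₂ : y₂ = x₂ - ‖v‖ ^ 2 / x₃) (h₂ : y₂ ≠ 0) :
    NormedSpace.exp (M.T ⟨0, 0, 0, 0, 0, x₃⁻¹ • v, 0, 0, 0⟩)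
      (NormedSpace.exp (M.T ⟨0, 0, 0, 0, x₃⁻¹ • s₁, 0, 0, 0, 0⟩)
        (NormedSpace.exp (M.T ⟨0, 0, 0, y₂⁻¹ • (s₀ - x₃⁻¹ • M.spinorDotCovector s₁ v),
            0, 0, 0, 0, 0⟩)
          (M.herm (M.cubic (M.herm x₁ x₂ x₃ v s₀ s₁) / (y₂ * x₃)) y₂ x₃ 0 0 0))) =
    M.herm x₁ x₂ x₃ v s₀ s₁ := by
  rw [exp_T_s₀, exp_T_s₁, exp_T_v]
  refine herm_ext ?_ ?_ ?_ ?_ ?_ ?_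
  -- The first entry is where the cubic arises: clearing the other two pivots leaves `cubic / (y₂
  -- x₃)`.
  · simp only [toMat_herm, inner_zero_right, norm_smul, mul_pow, norm_inv, Real.norm_eq_abs, sq_abs,
      inv_pow, map_zero, LinearMap.zero_apply, zero_add, real_inner_smul_left, norm_sub_sq_real,
      real_inner_smul_right, norm_spinorDotCovector_sq, cubic_def]
    rw [real_inner_comm (M.spinorDotCovector s₁ v), inner_spinorDotCovector,
      real_inner_comm _ v, inner_cospinorDotSpinor]
    have e : x₂ = y₂ + ‖v‖ ^ 2 / x₃ := by rw [hy₂]; ring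
    rw [e]
    field_simp
    ring
  · simp only [toMat_herm, inner_zero_right, norm_smul, mul_pow, norm_inv, Real.norm_eq_abs, sq_abs,
      inv_pow, hy₂]
    field_simp
    ring
  · rfl
  · simp [toMat_herm, smul_smul, h₃]
  · simp [toMat_herm, smul_smul, h₃, h₂, spinorDotCovector_zero_right,
      spinorDotCovector_smul_right]
  · simp [toMat_herm, smul_smul, h₃]

/-- A positive matrix in terms of the action of the lower triangular group. -/
theorem exp_lower {x₁ x₂ x₃ : ℝ} {v : V} {s₀ : M.part 0} {s₁ : M.part 1} (h₁ : x₁ ≠ 0) {y₂ : ℝ}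
    (hy₂ : y₂ = x₂ - ‖s₀‖ ^ 2 / x₁) (h₂ : y₂ ≠ 0) :
    NormedSpace.exp (M.T ⟨0, 0, 0, 0, 0, 0, x₁⁻¹ • s₀, 0, 0⟩)
      (NormedSpace.exp (M.T ⟨0, 0, 0, 0, 0, 0, 0, x₁⁻¹ • s₁, 0⟩)
        (NormedSpace.exp (M.T ⟨0, 0, 0, 0, 0, 0, 0, 0,
            y₂⁻¹ • (v - x₁⁻¹ • M.cospinorDotSpinor s₀ s₁)⟩)
          (M.herm x₁ y₂ (M.dualCubic (M.herm x₁ x₂ x₃ v s₀ s₁) / (x₁ * y₂)) 0 0 0))) =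
    M.herm x₁ x₂ x₃ v s₀ s₁ := by
  rw [exp_T_w, exp_T_t₁, exp_T_t₀]
  refine herm_ext ?_ ?_ ?_ ?_ ?_ ?_
  · rfl
  · simp only [toMat_herm, inner_zero_right, norm_smul, mul_pow, norm_inv, Real.norm_eq_abs, sq_abs,
      inv_pow, hy₂]
    field_simp
    ring
  -- Now the last pivot is the third entry, `dualCubic / (x₁ y₂)`.
  · simp only [toMat_herm, inner_zero_right, norm_smul, mul_pow, norm_inv, Real.norm_eq_abs, sq_abs,
      inv_pow, map_zero, zero_add, real_inner_smul_left, norm_sub_sq_real,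
      real_inner_smul_right, dualCubic, cubic_def]
    have e : x₂ = y₂ + ‖s₀‖ ^ 2 / x₁ := by rw [hy₂]; ring
    rw [e]
    field_simp
    ring
  · simp [toMat_herm, smul_smul, h₁, h₂, cospinorDotSpinor_zero_left, cospinorDotSpinor_zero_right,
      cospinorDotSpinor_smul_left]
  · simp [toMat_herm, smul_smul, h₁]
  · simp [toMat_herm, smul_smul, h₁]

theorem surjective_smul_exp (B : M.TAlgebra) {t : ℝ} (ht : 0 < t) :
    Function.Surjective (t • NormedSpace.exp (M.T B) : M.Herm →L[ℝ] M.Herm) := by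
  have := FiniteDimensional.complete ℝ M.Herm
  intro X
  obtain ⟨Y, hY⟩ := surjective_exp (M.T B) (t⁻¹ • X)
  refine ⟨Y, ?_⟩
  rw [_root_.smul_apply, hY, smul_smul, mul_inv_cancel₀ ht.ne', one_smul]

/-- Relative invariance under three unipotent operators and a diagonal one, evaluated at the
identity matrix. -/
theorem eq_of_semiinvariant {p q : M.Herm → ℝ} (hp : AnalyticOnNhd ℝ p Set.univ)
    (hq : AnalyticOnNhd ℝ q Set.univ) (hq0 : q ≠ 0) {A B C : M.TAlgebra} {y₁ y₂ y₃ : ℝ}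
    (h₁ : 0 < y₁) (h₂ : 0 < y₂) (h₃ : 0 < y₃) {X : M.Herm}
    (hX : NormedSpace.exp (M.T C) (NormedSpace.exp (M.T B) (NormedSpace.exp (M.T A)
      (M.herm y₁ y₂ y₃ 0 0 0))) = X)
    (hA : IsSemiinvariant p q (NormedSpace.exp (M.T A)) 1)
    (hB : IsSemiinvariant p q (NormedSpace.exp (M.T B)) 1)
    (hC : IsSemiinvariant p q (NormedSpace.exp (M.T C)) 1)
    (hD : ∀ b₁ b₂ b₃ t : ℝ, 0 < t → b₁ + b₂ + b₃ = 0 → IsSemiinvariant p q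
      (t • NormedSpace.exp (M.T ⟨b₁, b₂, b₃, 0, 0, 0, 0, 0, 0⟩)) (t ^ 3)) :
    p X * q M.one = y₁ * y₂ * y₃ * (p M.one * q X) := by
  have := FiniteDimensional.complete ℝ M.Herm
  obtain ⟨t, b₁, b₂, b₃, ht, ht3, hb, he⟩ := M.exists_diag h₁ h₂ h₃
  have s := M.surjective_smul_exp ⟨b₁, b₂, b₃, 0, 0, 0, 0, 0, 0⟩ ht
  have i₁ := (hD b₁ b₂ b₃ t ht hb).comp hp hq hq0 hA s
  have i₂ := i₁.comp hp hq hq0 hB ((surjective_exp _).comp s)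
  have i₃ := i₂.comp hp hq hq0 hC ((surjective_exp _).comp ((surjective_exp _).comp s))
  have := i₃ M.one
  simp only [ContinuousLinearMap.comp_apply] at this
  rw [he, hX] at this
  rw [this, ← ht3]
  ring

/-! ### Polynomiality of the cubics -/

/-- The entry `x₁`, as a linear map. -/
def entry₁ : M.Herm →L[ℝ] ℝ :=
  LinearMap.toContinuousLinearMap
    { toFun := fun X => (M.toMat X).x₁, map_add' := fun _ _ => rfl, map_smul' := fun _ _ => rfl }

/-- The entry `x₂`, as a linear map. -/
def entry₂ : M.Herm →L[ℝ] ℝ :=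
  LinearMap.toContinuousLinearMap
    { toFun := fun X => (M.toMat X).x₂, map_add' := fun _ _ => rfl, map_smul' := fun _ _ => rfl }

/-- The entry `x₃`, as a linear map. -/
def entry₃ : M.Herm →L[ℝ] ℝ :=
  LinearMap.toContinuousLinearMap
    { toFun := fun X => (M.toMat X).x₃, map_add' := fun _ _ => rfl, map_smul' := fun _ _ => rfl }

/-- The entry `v`, as a linear map. -/
def entryV : M.Herm →L[ℝ] V :=
  LinearMap.toContinuousLinearMap
    { toFun := fun X => (M.toMat X).v, map_add' := fun _ _ => rfl, map_smul' := fun _ _ => rfl }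

/-- The entry `s₀`, as a linear map. -/
def entryS₀ : M.Herm →L[ℝ] M.part 0 :=
  LinearMap.toContinuousLinearMap
    { toFun := fun X => (M.toMat X).s₀, map_add' := fun _ _ => rfl, map_smul' := fun _ _ => rfl }

/-- The entry `s₁`, as a linear map. -/
def entryS₁ : M.Herm →L[ℝ] M.part 1 :=
  LinearMap.toContinuousLinearMap
    { toFun := fun X => (M.toMat X).s₁, map_add' := fun _ _ => rfl, map_smul' := fun _ _ => rfl }

theorem isPolynomial_x₁ : IsPolynomial (fun X : M.Herm => (M.toMat X).x₁) :=
  isPolynomial_clm M.entry₁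

theorem isPolynomial_x₂ : IsPolynomial (fun X : M.Herm => (M.toMat X).x₂) :=
  isPolynomial_clm M.entry₂

theorem isPolynomial_x₃ : IsPolynomial (fun X : M.Herm => (M.toMat X).x₃) :=
  isPolynomial_clm M.entry₃

theorem isPolynomial_norm_v_sq : IsPolynomial (fun X : M.Herm => ‖(M.toMat X).v‖ ^ 2) :=
  isPolynomial_norm_sq M.entryV

theorem isPolynomial_norm_s₀_sq : IsPolynomial (fun X : M.Herm => ‖(M.toMat X).s₀‖ ^ 2) :=
  isPolynomial_norm_sq M.entryS₀

theorem isPolynomial_norm_s₁_sq : IsPolynomial (fun X : M.Herm => ‖(M.toMat X).s₁‖ ^ 2) :=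
  isPolynomial_norm_sq M.entryS₁

theorem isPolynomial_inner_cospinor (e : V) : IsPolynomial (fun X : M.Herm =>
    ⟪M.cospinorDotSpinor (M.toMat X).s₀ (M.toMat X).s₁, e⟫_ℝ) := by
  simp only [inner_cospinorDotSpinor]
  exact isPolynomial_inner ((LinearMap.toContinuousLinearMap (M.μ e)).comp M.entryS₀) M.entryS₁

/-- `s₀♭ · s₁` is quadratic in `X`, outside the scope of `isPolynomial_inner`; an orthonormal basis
of `V` reduces to its components. -/
theorem isPolynomial_inner_v_cospinor : IsPolynomial (fun X : M.Herm =>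
    ⟪(M.toMat X).v, M.cospinorDotSpinor (M.toMat X).s₀ (M.toMat X).s₁⟫_ℝ) := by
  have h : (fun X : M.Herm =>
      ⟪(M.toMat X).v, M.cospinorDotSpinor (M.toMat X).s₀ (M.toMat X).s₁⟫_ℝ) = fun X => ∑ i,
      (innerSL ℝ (stdOrthonormalBasis ℝ V i)).comp M.entryV X *
        ⟪M.cospinorDotSpinor (M.toMat X).s₀ (M.toMat X).s₁, stdOrthonormalBasis ℝ V i⟫_ℝ := by
    ext X
    rw [← (stdOrthonormalBasis ℝ V).sum_inner_mul_inner]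
    refine Finset.sum_congr rfl fun i _ => ?_
    rw [real_inner_comm, real_inner_comm (M.cospinorDotSpinor _ _)]
    rfl
  rw [h]
  exact isPolynomial_sum fun i => (isPolynomial_clm _).mul (M.isPolynomial_inner_cospinor _)

theorem isPolynomial_norm_cospinor_sq : IsPolynomial (fun X : M.Herm =>
    ‖M.cospinorDotSpinor (M.toMat X).s₀ (M.toMat X).s₁‖ ^ 2) := by
  have h : (fun X : M.Herm => ‖M.cospinorDotSpinor (M.toMat X).s₀ (M.toMat X).s₁‖ ^ 2) =
      fun X => ∑ i, ⟪M.cospinorDotSpinor (M.toMat X).s₀ (M.toMat X).s₁,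
        stdOrthonormalBasis ℝ V i⟫_ℝ ^ 2 := by
    ext X
    rw [← real_inner_self_eq_norm_sq, ← (stdOrthonormalBasis ℝ V).sum_inner_mul_inner]
    refine Finset.sum_congr rfl fun i _ => ?_
    rw [real_inner_comm _ (stdOrthonormalBasis ℝ V i), sq]
  rw [h]
  exact isPolynomial_sum fun i => (M.isPolynomial_inner_cospinor _).pow 2

theorem isPolynomial_cubic : IsPolynomial M.cubic := by
  have h : M.cubic = _ := funext M.cubic_def
  rw [h]
  exact (((M.isPolynomial_x₁.mul ((M.isPolynomial_x₂.mul M.isPolynomial_x₃).sub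
    M.isPolynomial_norm_v_sq)).sub (M.isPolynomial_x₂.mul M.isPolynomial_norm_s₁_sq)).sub
    (M.isPolynomial_x₃.mul M.isPolynomial_norm_s₀_sq)).add
    ((isPolynomial_const 2).mul M.isPolynomial_inner_v_cospinor)

/-- The numerator `x₁ · dualCubic` of the dual cubic. -/
def dualNum (X : M.Herm) : ℝ :=
  (M.toMat X).x₁ * M.cubic X + (‖(M.toMat X).s₀‖ ^ 2 * ‖(M.toMat X).s₁‖ ^ 2
    - ‖M.cospinorDotSpinor (M.toMat X).s₀ (M.toMat X).s₁‖ ^ 2)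

theorem isPolynomial_dualNum : IsPolynomial M.dualNum :=
  (M.isPolynomial_x₁.mul M.isPolynomial_cubic).add
    ((M.isPolynomial_norm_s₀_sq.mul M.isPolynomial_norm_s₁_sq).sub M.isPolynomial_norm_cospinor_sq)

theorem dualCubic_eq_div {X : M.Herm} (hX : (M.toMat X).x₁ ≠ 0) :
    M.dualCubic X = M.dualNum X / (M.toMat X).x₁ := by
  rw [dualCubic, dualNum]
  field_simp

theorem _root_.SpecialVinberg.IsPolynomial.contDiff {E : Type*} [NormedAddCommGroup E]
    [NormedSpace ℝ E] {p : E → ℝ} (hp : IsPolynomial p) : ContDiff ℝ ∞ p :=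
  contDiffOn_univ.1 (hp.analyticOnNhd.contDiffOn uniqueDiffOn_univ)

theorem cubic_one : M.cubic M.one = 1 := by
  simp [cubic, one_eq_herm, toMat_herm]

/-! ### Determination of the invariant cubics -/

/-- The polynomial is treated as a fraction with denominator 1. Near the identity all three pivots
are positive, so elimination applies, and analyticity extends the formula. -/
theorem eq_cubic_of_isInvariantCubic {d : M.Herm → ℝ} (hd : M.IsInvariantCubic d) (X : M.Herm) :
    d X = d M.one * M.cubic X := by
  obtain ⟨hp, -, hinv⟩ := hd
  have hs : ∀ B : M.TAlgebra, B.IsUpper → B.tr = 0 → ∀ t : ℝ, 0 < t →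
      IsSemiinvariant d (fun _ => 1) (t • NormedSpace.exp (M.T B)) (t ^ 3) := by
    intro B hB hB' t ht X
    simpa using hinv B hB hB' t ht X
  have hs1 : ∀ B : M.TAlgebra, B.IsUpper → B.tr = 0 →
      IsSemiinvariant d (fun _ => 1) (NormedSpace.exp (M.T B)) 1 := by
    intro B hB hB'
    simpa using hs B hB hB' 1 one_pos
  refine congrFun (hp.analyticOnNhd.eq_of_eventuallyEq (g := fun X => d M.one * M.cubic X)
    ((isPolynomial_const _).mul M.isPolynomial_cubic).analyticOnNhd (z₀ := M.one) ?_) X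
  have e₁ : ∀ᶠ X in nhds M.one, 0 < (M.toMat X).x₃ :=
    M.isPolynomial_x₃.contDiff.continuous.continuousAt.eventually_const_lt
      (by simp [one_eq_herm, toMat_herm])
  have e₂ : ∀ᶠ X in nhds M.one, 0 < (M.toMat X).x₂ * (M.toMat X).x₃ - ‖(M.toMat X).v‖ ^ 2 :=
    ((M.isPolynomial_x₂.mul M.isPolynomial_x₃).sub
      M.isPolynomial_norm_v_sq).contDiff.continuous.continuousAt.eventually_const_lt
      (by simp [one_eq_herm, toMat_herm])
  have e₃ : ∀ᶠ X in nhds M.one, 0 < M.cubic X :=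
    M.isPolynomial_cubic.contDiff.continuous.continuousAt.eventually_const_lt
      (by simp [cubic_one])
  filter_upwards [e₁, e₂, e₃] with X h₁ h₂ h₃
  have hy : 0 < (M.toMat X).x₂ - ‖(M.toMat X).v‖ ^ 2 / (M.toMat X).x₃ := by
    rw [sub_pos, div_lt_iff₀ h₁]
    linarith
  have key := M.eq_of_semiinvariant hp.analyticOnNhd (analyticOnNhd_const (v := (1 : ℝ)))
    (fun h => one_ne_zero (congrFun h M.one)) (by positivity) hy h₁
    (M.exp_upper (x₁ := (M.toMat X).x₁) (s₀ := (M.toMat X).s₀) (s₁ := (M.toMat X).s₁)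
      h₁.ne' rfl hy.ne')
    (hs1 _ ⟨rfl, rfl, rfl⟩ (by simp [TAlgebra.tr])) (hs1 _ ⟨rfl, rfl, rfl⟩ (by simp [TAlgebra.tr]))
    (hs1 _ ⟨rfl, rfl, rfl⟩ (by simp [TAlgebra.tr]))
    (fun b₁ b₂ b₃ t ht hb => hs ⟨b₁, b₂, b₃, 0, 0, 0, 0, 0, 0⟩ ⟨rfl, rfl, rfl⟩ hb t ht)
  rw [herm_toMat] at key
  rw [mul_one, mul_one] at key
  rw [key]
  field_simp

theorem y₁_flat (X : M.Herm) : M.y₁ (M.flat X) = (M.toMat X).x₁ := by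
  rw [y₁, flat_apply]
  simp [e₁, toMat]

theorem eq_dualCubic_of_isDualInvariantCubic {r : RationalFunction (StrongDual ℝ M.Herm)}
    (hr : M.IsDualInvariantCubic r) (h1 : r.eval (M.flat M.one) ≠ 0) (X : M.Herm)
    (hX : (M.toMat X).x₁ ≠ 0) : r.RegularAt (M.flat X) ∧
      r.eval (M.flat X) = r.eval (M.flat M.one) * M.dualCubic X := by
  have hreg : r.RegularAt (M.flat M.one) := by
    -- Off its domain `eval` is 0 by convention, so a nonzero value proves regularity.
    by_contra h
    exact h1 (by rw [RationalFunction.eval, dif_neg h])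
  -- This fraction need not be `r.num / r.den`: its denominator is nonzero at `I♭`, which that of
  -- `r` may not be.
  obtain ⟨⟨P, Q⟩, hP, hQ, hPQ, hQ1⟩ := hreg
  dsimp only at hP hQ hPQ hQ1
  have hev := fun ξ (hξ : Q ξ ≠ 0) => r.eval_eq hP hQ hPQ hξ
  set k := r.eval (M.flat M.one) with hk
  have hk' : k = P (M.flat M.one) / Q (M.flat M.one) := (hev _ hQ1).2
  set p : M.Herm → ℝ := fun X => P (M.flatEquiv X) with hp
  set q : M.Herm → ℝ := fun X => Q (M.flatEquiv X) with hq
  have pp : IsPolynomial p := hP.comp_clm (M.flatEquiv : M.Herm →L[ℝ] StrongDual ℝ M.Herm)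
  have pq : IsPolynomial q := hQ.comp_clm (M.flatEquiv : M.Herm →L[ℝ] StrongDual ℝ M.Herm)
  have hq0 : q ≠ 0 := fun h => hQ1 (congrFun h M.one)
  have hs : ∀ L : M.TAlgebra, (star L).IsUpper → L.tr = 0 → ∀ t : ℝ, 0 < t →
      IsSemiinvariant p q (t • NormedSpace.exp (M.T L)) (t ^ 3) := by
    intro L hL hL' t ht
    refine isSemiinvariant_of_ne pp.analyticOnNhd pq.analyticOnNhd pq.analyticOnNhd hq0
      (M.surjective_smul_exp L ht) fun X hX hgX => ?_
    have hU : ((-1 : ℝ) • star L).IsUpper := by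
      obtain ⟨a, b, c⟩ := hL
      simp [TAlgebra.IsUpper, TAlgebra.smul_def, a, b, c]
    have ht0 : ((-1 : ℝ) • star L).tr = 0 := by
      simp only [TAlgebra.tr, TAlgebra.smul_def, TAlgebra.star_def] at hL' ⊢
      linarith
    have e : t • M.dualAct ((-1 : ℝ) • star L) (M.flat X) =
        M.flatEquiv ((t • NormedSpace.exp (M.T L)) X) := by
      rw [dualAct_flat, _root_.smul_apply, map_smul, flatEquiv_apply]
    have h' := hr.2 _ hU ht0 t ht (M.flat X) (hev _ hX).1 (by rw [e]; exact (hev _ hgX).1)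
    rw [e, ← flatEquiv_apply, (hev _ hX).2, (hev _ hgX).2] at h'
    change p _ / q _ = t ^ 3 * (p X / q X) at h'
    rw [← mul_div_assoc, div_eq_div_iff hgX hX] at h'
    rw [h']
    ring
  have hs1 : ∀ L : M.TAlgebra, (star L).IsUpper → L.tr = 0 →
      IsSemiinvariant p q (NormedSpace.exp (M.T L)) 1 := by
    intro B hB hB'
    simpa using hs B hB hB' 1 one_pos
  -- Cross-multiplied form of `p / q = k · dualNum / x₁`. Both sides are polynomial, so lower
  -- elimination near the identity suffices.
  have key : (fun X => (M.toMat X).x₁ * p X) = fun X => k * (M.dualNum X * q X) := by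
    refine (M.isPolynomial_x₁.mul pp).analyticOnNhd.eq_of_eventuallyEq
      ((isPolynomial_const k).mul (M.isPolynomial_dualNum.mul pq)).analyticOnNhd (z₀ := M.one) ?_
    have e₁ : ∀ᶠ X in nhds M.one, 0 < (M.toMat X).x₁ :=
      M.isPolynomial_x₁.contDiff.continuous.continuousAt.eventually_const_lt
        (by simp [one_eq_herm, toMat_herm])
    have e₂ : ∀ᶠ X in nhds M.one, 0 < (M.toMat X).x₁ * (M.toMat X).x₂ - ‖(M.toMat X).s₀‖ ^ 2 :=
      ((M.isPolynomial_x₁.mul M.isPolynomial_x₂).sub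
        M.isPolynomial_norm_s₀_sq).contDiff.continuous.continuousAt.eventually_const_lt
        (by simp [one_eq_herm, toMat_herm])
    have e₃ : ∀ᶠ X in nhds M.one, 0 < M.dualNum X :=
      M.isPolynomial_dualNum.contDiff.continuous.continuousAt.eventually_const_lt
        (by simp [dualNum, cubic_one, one_eq_herm, toMat_herm, cospinorDotSpinor_zero_left]
            simp [← one_eq_herm, cubic_one])
    filter_upwards [e₁, e₂, e₃] with X h₁ h₂ h₃
    have hy : 0 < (M.toMat X).x₂ - ‖(M.toMat X).s₀‖ ^ 2 / (M.toMat X).x₁ := by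
      rw [sub_pos, div_lt_iff₀ h₁]
      linarith
    have h₄ : 0 < M.dualCubic X := by
      rw [M.dualCubic_eq_div h₁.ne']
      positivity
    have key := M.eq_of_semiinvariant pp.analyticOnNhd pq.analyticOnNhd hq0 h₁ hy (by positivity)
      (M.exp_lower (v := (M.toMat X).v) (x₃ := (M.toMat X).x₃) (s₁ := (M.toMat X).s₁)
        h₁.ne' rfl hy.ne')
      (hs1 _ ⟨rfl, rfl, rfl⟩ (by simp [TAlgebra.tr]))
      (hs1 _ ⟨rfl, rfl, rfl⟩ (by simp [TAlgebra.tr]))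
      (hs1 _ ⟨rfl, rfl, rfl⟩ (by simp [TAlgebra.tr]))
      (fun b₁ b₂ b₃ t ht hb => hs ⟨b₁, b₂, b₃, 0, 0, 0, 0, 0, 0⟩ ⟨rfl, rfl, rfl⟩ hb t ht)
    rw [herm_toMat, mul_div_cancel₀ _ (mul_pos h₁ hy).ne', M.dualCubic_eq_div h₁.ne'] at key
    have hk'' : k = p M.one / q M.one := hk'
    have hq1 : q M.one ≠ 0 := hQ1
    rw [hk'']
    field_simp at key ⊢
    linear_combination key
  have poly₁ : IsPolynomial (fun ξ : StrongDual ℝ M.Herm => M.y₁ ξ) :=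
    isPolynomial_clm (ContinuousLinearMap.apply ℝ ℝ M.e₁)
  have poly₂ : IsPolynomial (fun ξ : StrongDual ℝ M.Herm => k * M.dualNum (M.flatEquiv.symm ξ)) :=
    (isPolynomial_const k).mul
      (M.isPolynomial_dualNum.comp_clm (M.flatEquiv.symm : StrongDual ℝ M.Herm →L[ℝ] M.Herm))
  -- After cancelling `Q`, `r` itself is represented with denominator `y₁`, which gives regularity
  -- wherever `y₁ ≠ 0`, even at zeros of `Q`.
  have hfrac : r.num * (fun ξ => M.y₁ ξ) =
      (fun ξ => k * M.dualNum (M.flatEquiv.symm ξ)) * r.den := by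
    rcases eq_zero_or_eq_zero_of_analytic hQ.analyticOnNhd
      ((r.num_poly.mul poly₁).sub (poly₂.mul r.den_poly)).analyticOnNhd (fun ξ => by
        obtain ⟨X, rfl⟩ := M.flatEquiv.surjective ξ
        have a := congrFun key X
        have b := congrFun hPQ (M.flatEquiv X)
        rw [flatEquiv_apply, y₁_flat, ← flatEquiv_apply, ContinuousLinearEquiv.symm_apply_apply]
        simp only [Pi.mul_apply, hp, hq] at a b ⊢
        linear_combination (M.toMat X).x₁ * b + r.den (M.flatEquiv X) * a) with h0 | h0
    · exact absurd (congrFun h0 (M.flat M.one)) hQ1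
    · ext ξ
      exact sub_eq_zero.1 (congrFun h0 ξ)
  have hX' : M.y₁ (M.flat X) ≠ 0 := by rwa [y₁_flat]
  obtain ⟨a, b⟩ := r.eval_eq poly₂ poly₁ hfrac hX'
  refine ⟨a, b.trans ?_⟩
  rw [y₁_flat, ← flatEquiv_apply, ContinuousLinearEquiv.symm_apply_apply, M.dualCubic_eq_div hX,
    mul_div_assoc]

/-! ### Gradients -/

theorem hasDerivAt_line {W : Type*} [NormedAddCommGroup W] [NormedSpace ℝ W] (x y : W) :
    HasDerivAt (fun s : ℝ => x + s • y) y 0 := by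
  simpa using ((hasDerivAt_id (0 : ℝ)).smul_const y).const_add x

theorem hasDerivAt_line_mul (x y : ℝ) : HasDerivAt (fun s : ℝ => x + s * y) y 0 :=
  hasDerivAt_line x y

theorem hasDerivAt_line_norm_sq {W : Type*} [NormedAddCommGroup W] [InnerProductSpace ℝ W]
    (x y : W) : HasDerivAt (fun s : ℝ => ‖x + s • y‖ ^ 2) (2 * ⟪x, y⟫_ℝ) 0 := by
  simpa using (hasDerivAt_line x y).norm_sq

theorem hasDerivAt_line_cospinor (s₀ t₀ : M.part 0) (s₁ t₁ : M.part 1) :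
    HasDerivAt (fun s : ℝ => M.cospinorDotSpinor (s₀ + s • t₀) (s₁ + s • t₁))
      (M.cospinorDotSpinor t₀ s₁ + M.cospinorDotSpinor s₀ t₁) 0 := by
  have h : (fun s : ℝ => M.cospinorDotSpinor (s₀ + s • t₀) (s₁ + s • t₁)) = fun s : ℝ =>
      (M.cospinorDotSpinor s₀ s₁ + s • (M.cospinorDotSpinor t₀ s₁ + M.cospinorDotSpinor s₀ t₁))
        + (s ^ 2) • M.cospinorDotSpinor t₀ t₁ := by
    ext s
    simp only [cospinorDotSpinor_add_left, cospinorDotSpinor_add_right,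
      cospinorDotSpinor_smul_left, cospinorDotSpinor_smul_right]
    module
  rw [h]
  simpa using (hasDerivAt_line (M.cospinorDotSpinor s₀ s₁)
    (M.cospinorDotSpinor t₀ s₁ + M.cospinorDotSpinor s₀ t₁)).fun_add
    (((hasDerivAt_id (0 : ℝ)).pow 2).smul_const (M.cospinorDotSpinor t₀ t₁))

theorem fderiv_apply_of_hasDerivAt_line {E : Type*} [NormedAddCommGroup E] [NormedSpace ℝ E]
    {f : E → ℝ} {x y : E} {c : ℝ} (hf : DifferentiableAt ℝ f x)
    (h : HasDerivAt (fun s : ℝ => f (x + s • y)) c 0) : fderiv ℝ f x y = c := by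
  rw [← hf.lineDeriv_eq_fderiv]
  exact HasLineDerivAt.lineDeriv h

theorem hasDerivAt_line_cubic (X Y : M.Herm) :
    HasDerivAt (fun s : ℝ => M.cubic (X + s • Y)) (M.flat (M.adj X) Y) 0 := by
  simp only [cubic_def, toMat_add, toMat_smul, TAlgebra.add_def, TAlgebra.smul_def]
  generalize hA : M.toMat X = A
  generalize hB : M.toMat Y = B
  have h₁ := hasDerivAt_line_mul A.x₁ B.x₁
  have h₂ := hasDerivAt_line_mul A.x₂ B.x₂
  have h₃ := hasDerivAt_line_mul A.x₃ B.x₃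
  have h₄ := hasDerivAt_line_norm_sq A.v B.v
  have h₅ := hasDerivAt_line_norm_sq A.s₀ B.s₀
  have h₆ := hasDerivAt_line_norm_sq A.s₁ B.s₁
  have h₇ := (hasDerivAt_line A.v B.v).inner ℝ (M.hasDerivAt_line_cospinor A.s₀ B.s₀ A.s₁ B.s₁)
  have := (((h₁.mul ((h₂.mul h₃).sub h₄)).sub (h₂.mul h₆)).sub (h₃.mul h₅)).add (h₇.const_mul 2)
  refine HasDerivAt.congr_deriv this ?_
  have hadj : M.toMat (M.adj X) = M.toMat (M.herm (A.x₂ * A.x₃ - ‖A.v‖ ^ 2)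
    (A.x₁ * A.x₃ - ‖A.s₁‖ ^ 2) (A.x₁ * A.x₂ - ‖A.s₀‖ ^ 2)
    (M.cospinorDotSpinor A.s₀ A.s₁ - A.x₁ • A.v)
    (M.spinorDotCovector A.s₁ A.v - A.x₃ • A.s₀) (M.μ A.v A.s₀ - A.x₂ • A.s₁)) := by
    rw [← hA]; rfl
  rw [flat_apply, hadj, hB, toMat_herm]
  simp only [Pi.sub_apply, Pi.mul_apply, inner_sub_left, real_inner_smul_left,
    inner_spinorDotCovector, inner_add_right,
    real_inner_comm (M.cospinorDotSpinor _ _), inner_cospinorDotSpinor, zero_smul, zero_mul,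
    add_zero]
  ring

theorem hasDerivAt_line_dualCubic (X Y : M.Herm) (hX : (M.toMat X).x₁ ≠ 0) :
    HasDerivAt (fun s : ℝ => M.dualCubic (X + s • Y)) (M.flat (M.dualAdj X) Y) 0 := by
  have h₀ := M.hasDerivAt_line_cubic X Y
  simp only [dualCubic]
  simp only [toMat_add, toMat_smul, TAlgebra.add_def, TAlgebra.smul_def]
  rw [flat_apply] at h₀ ⊢
  have hadj : M.toMat (M.adj X) = M.toMat (M.herm _ _ _ _ _ _) := rfl
  have hdual : M.toMat (M.dualAdj X) = M.toMat (M.herm _ _ _ _ _ _) := rfl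
  rw [hadj, toMat_herm] at h₀
  rw [hdual, toMat_herm]
  simp only [red₂, red₃, norm_redV_sq]
  simp only [redV]
  generalize hA : M.toMat X = A at *
  generalize hB : M.toMat Y = B at *
  have h₁ := hasDerivAt_line_mul A.x₁ B.x₁
  have h₅ := hasDerivAt_line_norm_sq A.s₀ B.s₀
  have h₆ := hasDerivAt_line_norm_sq A.s₁ B.s₁
  have h₇ := (M.hasDerivAt_line_cospinor A.s₀ B.s₀ A.s₁ B.s₁).norm_sq
  have := h₀.add (((h₅.mul h₆).sub h₇).div h₁ (by simpa using hX))
  refine HasDerivAt.congr_deriv this ?_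
  simp only [inner_sub_left, real_inner_smul_left, inner_spinorDotCovector, inner_add_right,
    ← inner_cospinorDotSpinor, inner_neg_left, zero_smul, zero_mul, add_zero, Pi.sub_apply,
    Pi.mul_apply, inner_sub_right, real_inner_smul_right, real_inner_self_eq_norm_sq]
  simp only [real_inner_comm]
  field_simp
  ring

theorem flat_comm (X Y : M.Herm) : M.flat X Y = M.flat Y X := by
  simp only [flat_apply, real_inner_comm]
  ring

theorem isOpen_y₁_ne : IsOpen {ξ : StrongDual ℝ M.Herm | M.y₁ ξ ≠ 0} :=
  isOpen_ne_fun (ContinuousLinearMap.apply ℝ ℝ M.e₁).continuous continuous_const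

theorem contDiffOn_dualCubic : ContDiffOn ℝ ∞ M.dualCubic {X | (M.toMat X).x₁ ≠ 0} :=
  (M.isPolynomial_dualNum.contDiff.contDiffOn.div M.isPolynomial_x₁.contDiff.contDiffOn
    fun _ h => h).congr fun _ hX => M.dualCubic_eq_div hX

theorem isOpen_x₁_ne : IsOpen {X : M.Herm | (M.toMat X).x₁ ≠ 0} :=
  isOpen_ne_fun M.isPolynomial_x₁.contDiff.continuous continuous_const

theorem fderiv_cubic (X : M.Herm) : fderiv ℝ M.cubic X = M.flat (M.adj X) := by
  ext Y
  exact fderiv_apply_of_hasDerivAt_line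
    (M.isPolynomial_cubic.contDiff.differentiable (by simp) X) (M.hasDerivAt_line_cubic X Y)

theorem fderiv_dualCubic (X : M.Herm) (hX : (M.toMat X).x₁ ≠ 0) :
    fderiv ℝ M.dualCubic X = M.flat (M.dualAdj X) := by
  ext Y
  exact fderiv_apply_of_hasDerivAt_line
    ((M.contDiffOn_dualCubic.contDiffAt (M.isOpen_x₁_ne.mem_nhds hX)).differentiableAt (by simp))
    (M.hasDerivAt_line_dualCubic X Y hX)

theorem flat_smul (c : ℝ) (X : M.Herm) : M.flat (c • X) = c • M.flat X := M.flatₗ.map_smul c X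

theorem quadraticMap_eq {d : M.Herm → ℝ} {k : ℝ} (hd : ∀ X, d X = k * M.cubic X) (X : M.Herm) :
    quadraticMap d X = M.flat ((k / 3) • M.adj X) := by
  have h : d = fun X => k • M.cubic X := funext hd
  rw [quadraticMap, h, fderiv_fun_const_smul (M.isPolynomial_cubic.contDiff.differentiable
    (by simp) X), fderiv_cubic, flat_smul, smul_smul]
  congr 1
  ring

/-- The formula for `f` holds only off `y₁ = 0`, an open condition, so it may be differentiated
there. Symmetry of the trace form identifies the derivative with an element of the bidual. -/
theorem dualQuadraticMap_eq {f : StrongDual ℝ M.Herm → ℝ} {k : ℝ}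
    (hf : ∀ X, (M.toMat X).x₁ ≠ 0 → f (M.flat X) = k * M.dualCubic X) (X : M.Herm)
    (hX : (M.toMat X).x₁ ≠ 0) : dualQuadraticMap f (M.flat X) = (k / 3) • M.dualAdj X := by
  rw [dualQuadraticMap, LinearEquiv.symm_apply_eq]
  have he : f =ᶠ[nhds (M.flat X)] fun ξ => k • M.dualCubic (M.flatEquiv.symm ξ) := by
    filter_upwards [M.isOpen_y₁_ne.mem_nhds (show M.y₁ (M.flat X) ≠ 0 by rwa [y₁_flat])] with ξ hξ
    obtain ⟨Y, rfl⟩ := M.flatEquiv.surjective ξ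
    rw [ContinuousLinearEquiv.symm_apply_apply, flatEquiv_apply, smul_eq_mul]
    exact hf Y (by rwa [← y₁_flat])
  have hx : M.flatEquiv.symm (M.flat X) = X := M.flatEquiv.symm_apply_apply X
  have hd : HasFDerivAt M.dualCubic (M.flat (M.dualAdj X)) (M.flatEquiv.symm (M.flat X)) := by
    rw [hx, ← M.fderiv_dualCubic X hX]
    exact ((M.contDiffOn_dualCubic.contDiffAt (M.isOpen_x₁_ne.mem_nhds hX)).differentiableAt
      (by simp)).hasFDerivAt
  have hd' := (hd.comp (M.flat X) M.flatEquiv.symm.hasFDerivAt).const_smul k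
  have hfd : fderiv ℝ f (M.flat X) = k • (M.flat (M.dualAdj X)).comp
      (M.flatEquiv.symm : StrongDual ℝ M.Herm →L[ℝ] M.Herm) := he.fderiv_eq.trans hd'.fderiv
  ext ξ
  obtain ⟨Y, rfl⟩ := M.flatEquiv.surjective ξ
  rw [bidualEquiv_apply, quadraticMap, hfd]
  simp only [_root_.smul_apply, ContinuousLinearMap.comp_apply, ContinuousLinearEquiv.coe_coe,
    ContinuousLinearEquiv.symm_apply_apply, map_smul, smul_eq_mul]
  rw [flatEquiv_apply]
  rw [M.flat_comm (M.dualAdj X) Y]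
  ring

/-! ### Values and homogeneity -/

/-- With `q` the first entry of `adj X`, the pivot formula gives `q · (cubic X / q)² · (x₂x₃ -
|v|²)`, and the last factor is `q` again. -/
theorem dualCubic_adj (X : M.Herm) (hX : (M.toMat (M.adj X)).x₁ ≠ 0) :
    M.dualCubic (M.adj X) = M.cubic X ^ 2 := by
  rw [M.dualCubic_eq _ hX, M.red₂_adj X hX, M.red₃_adj X hX, M.redV_adj X hX, norm_smul, mul_pow,
    Real.norm_eq_abs, sq_abs]
  have hq : (M.toMat (M.adj X)).x₁ = (M.toMat X).x₂ * (M.toMat X).x₃ - ‖(M.toMat X).v‖ ^ 2 := rfl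
  field_simp
  rw [hq]
  ring

theorem cubic_dualAdj (X : M.Herm) (hX : (M.toMat X).x₁ ≠ 0) :
    M.cubic (M.dualAdj X) = M.dualCubic X ^ 2 := by
  rw [M.dualCubic_eq X hX, cubic_def]
  have h : M.toMat (M.dualAdj X) = M.toMat (M.herm _ _ _ _ _ _) := rfl
  rw [h, toMat_herm]
  simp only [cospinorDotSpinor_adj, norm_spinorDotCovector_sub_sq, norm_μ_sub_sq, norm_neg,
    norm_smul, mul_pow, Real.norm_eq_abs, sq_abs, inner_neg_left, real_inner_smul_left,
    inner_add_right, real_inner_smul_right, real_inner_self_eq_norm_sq]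
  field_simp
  ring

theorem cubic_smul (c : ℝ) (X : M.Herm) : M.cubic (c • X) = c ^ 3 * M.cubic X := by
  simp only [cubic, toMat_smul, TAlgebra.smul_def, norm_smul, mul_pow, Real.norm_eq_abs, sq_abs,
    map_smul, LinearMap.smul_apply, real_inner_smul_left, real_inner_smul_right]
  ring

theorem adj_smul (c : ℝ) (X : M.Herm) : M.adj (c • X) = c ^ 2 • M.adj X := by
  have h : M.toMat (M.adj X) = M.toMat (M.herm _ _ _ _ _ _) := rfl
  have h' : M.toMat (M.adj (c • X)) = M.toMat (M.herm _ _ _ _ _ _) := rfl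
  refine herm_ext ?_ ?_ ?_ ?_ ?_ ?_ <;>
    simp only [h, h', toMat_herm, toMat_smul, TAlgebra.smul_def, norm_smul, mul_pow,
      Real.norm_eq_abs, sq_abs, map_smul, LinearMap.smul_apply, spinorDotCovector_smul_left,
      spinorDotCovector_smul_right, cospinorDotSpinor_smul_left, cospinorDotSpinor_smul_right]
  all_goals first | ring1 | module

theorem dualCubic_smul {c : ℝ} (hc : c ≠ 0) (X : M.Herm) :
    M.dualCubic (c • X) = c ^ 3 * M.dualCubic X := by
  simp only [dualCubic, cubic_smul, toMat_smul, TAlgebra.smul_def, norm_smul, mul_pow,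
    Real.norm_eq_abs, sq_abs, cospinorDotSpinor_smul_left, cospinorDotSpinor_smul_right]
  field_simp

theorem dualAdj_smul {c : ℝ} (hc : c ≠ 0) (X : M.Herm) :
    M.dualAdj (c • X) = c ^ 2 • M.dualAdj X := by
  have h : M.toMat (M.dualAdj X) = M.toMat (M.herm _ _ _ _ _ _) := rfl
  have h' : M.toMat (M.dualAdj (c • X)) = M.toMat (M.herm _ _ _ _ _ _) := rfl
  have e₂ : M.red₂ (c • X) = c * M.red₂ X := by
    simp only [red₂, toMat_smul, TAlgebra.smul_def, norm_smul, mul_pow, Real.norm_eq_abs, sq_abs]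
    field_simp
  have e₃ : M.red₃ (c • X) = c * M.red₃ X := by
    simp only [red₃, toMat_smul, TAlgebra.smul_def, norm_smul, mul_pow, Real.norm_eq_abs, sq_abs]
    field_simp
  have ev : M.redV (c • X) = c • M.redV X := by
    simp only [redV, toMat_smul, TAlgebra.smul_def, cospinorDotSpinor_smul_left,
      cospinorDotSpinor_smul_right, smul_sub, smul_smul]
    congr 2
    field_simp
  refine herm_ext ?_ ?_ ?_ ?_ ?_ ?_ <;>
    simp only [h, h', toMat_herm, toMat_smul, TAlgebra.smul_def, norm_smul, mul_pow,
      Real.norm_eq_abs, sq_abs, map_smul, LinearMap.smul_apply, spinorDotCovector_smul_left,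
      spinorDotCovector_smul_right, cospinorDotSpinor_smul_left, cospinorDotSpinor_smul_right,
      e₂, e₃, ev, real_inner_smul_left, real_inner_smul_right]
  · field_simp
  all_goals first | ring1 | module

/-! ### The quadratic map and its inverse -/

theorem toMat_smul_x₁ (c : ℝ) (X : M.Herm) : (M.toMat (c • X)).x₁ = c * (M.toMat X).x₁ := rfl

theorem contDiffOn_of_flat {f : StrongDual ℝ M.Herm → ℝ} {k : ℝ}
    (hf : ∀ X, (M.toMat X).x₁ ≠ 0 → f (M.flat X) = k * M.dualCubic X) :
    ContDiffOn ℝ ∞ f {ξ | M.y₁ ξ ≠ 0} := by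
  have hmaps : Set.MapsTo M.flatEquiv.symm {ξ | M.y₁ ξ ≠ 0} {X | (M.toMat X).x₁ ≠ 0} := by
    intro ξ hξ
    obtain ⟨X, rfl⟩ := M.flatEquiv.surjective ξ
    rw [ContinuousLinearEquiv.symm_apply_apply]
    exact fun h => hξ ((M.y₁_flat X).trans h)
  refine (contDiffOn_const (c := k)).mul
    (M.contDiffOn_dualCubic.comp M.flatEquiv.symm.contDiff.contDiffOn hmaps) |>.congr fun ξ hξ => ?_
  obtain ⟨X, rfl⟩ := M.flatEquiv.surjective ξ
  have := hmaps hξ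
  rw [ContinuousLinearEquiv.symm_apply_apply] at this
  simp only [Function.comp_apply, ContinuousLinearEquiv.symm_apply_apply]
  exact hf X this

/-- Here `D` stands for `cubic X`, and `k' (k / 3)³ D²` is the dual cubic at `h(X)`. The root of
`D²` is `ε D`, the only place where the sign of `d` enters the left inverse. -/
theorem sqrt_mul_one_div_sqrt {k k' D ε : ℝ} (hk : 0 < k) (hk' : 0 < k') (hε : ε = 1 ∨ ε = -1)
    (hD : 0 < ε * D) : √(27 / (k * k')) * (1 / √(k' * ((k / 3) ^ 3 * D ^ 2))) =
      27 / (k ^ 2 * k' * (ε * D)) := by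
  have hε2 : ε ^ 2 = 1 := by rcases hε with rfl | rfl <;> norm_num
  have hD2 : D ^ 2 = (ε * D) ^ 2 := by rw [mul_pow, hε2, one_mul]
  rw [hD2]
  rw [mul_one_div, ← Real.sqrt_div (by positivity)]
  rw [show 27 / (k * k') / (k' * ((k / 3) ^ 3 * (ε * D) ^ 2)) = (27 / (k ^ 2 * k' * (ε * D))) ^ 2 by
    field_simp
    norm_num]
  exact Real.sqrt_sq (by positivity)

/-- The quadratic map is a diffeomorphism of each of the two sets `{± d > 0, y₁ ∘ h ≠ 0}`. -/
theorem isDiffeoWithInverse_quadraticMap {d : M.Herm → ℝ} {f : StrongDual ℝ M.Herm → ℝ} {k k' : ℝ}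
    (hk : 0 < k) (hk' : 0 < k') (hd : ∀ X, d X = k * M.cubic X)
    (hf : ∀ X, (M.toMat X).x₁ ≠ 0 → f (M.flat X) = k' * M.dualCubic X) {ε : ℝ}
    (hε : ε = 1 ∨ ε = -1) :
    IsDiffeoWithInverse (quadraticMap d)
      (fun ξ => ε • ((√(27 / (k * k')) * (1 / √(f ξ))) • dualQuadraticMap f ξ))
      {X | 0 < ε * d X ∧ M.y₁ (quadraticMap d X) ≠ 0} {ξ | 0 < f ξ ∧ M.y₁ ξ ≠ 0} := by
  have hε2 : ε * ε = 1 := by rcases hε with rfl | rfl <;> norm_num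
  have hdc : ContDiff ℝ ∞ d := by
    have : d = fun X => k * M.cubic X := funext hd
    rw [this]
    exact contDiff_const.mul M.isPolynomial_cubic.contDiff
  have hqc : ContDiff ℝ ∞ (quadraticMap d) :=
    (contDiff_const (c := (1 / 3 : ℝ))).smul (hdc.fderiv_right (m := ∞) (by simp))
  have hfc := M.contDiffOn_of_flat hf
  have hy₁ : Continuous fun ξ : StrongDual ℝ M.Herm => M.y₁ ξ :=
    (ContinuousLinearMap.apply ℝ ℝ M.e₁).continuous
  have hopen : IsOpen {X | 0 < ε * d X ∧ M.y₁ (quadraticMap d X) ≠ 0} :=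
    (isOpen_lt continuous_const (continuous_const.mul hdc.continuous)).inter
      (isOpen_ne_fun (hy₁.comp hqc.continuous) continuous_const)
  have hopen' : IsOpen {ξ | 0 < f ξ ∧ M.y₁ ξ ≠ 0} := by
    -- `f` is known to be continuous only where `y₁ ≠ 0`, so openness is obtained inside that set.
    have := hfc.continuousOn.isOpen_inter_preimage M.isOpen_y₁_ne (isOpen_Ioi (a := (0 : ℝ)))
    exact (congrArg IsOpen (Set.ext fun ξ => and_comm)).mp this
  have hq := M.quadraticMap_eq hd
  have hleft : ∀ X, 0 < ε * d X → M.y₁ (quadraticMap d X) ≠ 0 → 0 < f (quadraticMap d X) ∧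
      ε • ((√(27 / (k * k')) * (1 / √(f (quadraticMap d X)))) •
        dualQuadraticMap f (quadraticMap d X)) = X := by
    intro X hX hX'
    rw [hq, y₁_flat] at hX'
    have hadj : (M.toMat (M.adj X)).x₁ ≠ 0 := by
      rw [toMat_smul_x₁] at hX'
      exact right_ne_zero_of_mul hX'
    have hk3 : k / 3 ≠ 0 := by positivity
    have hD : 0 < ε * M.cubic X := by
      rw [hd] at hX
      have : ε * (k * M.cubic X) = k * (ε * M.cubic X) := by ring
      rw [this] at hX
      exact pos_of_mul_pos_right hX hk.le
    have hD0 : M.cubic X ≠ 0 := right_ne_zero_of_mul hD.ne'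
    rw [hq, hf _ hX', M.dualQuadraticMap_eq hf _ hX', M.dualCubic_smul hk3, M.dualCubic_adj X hadj,
      M.dualAdj_smul hk3, M.dualAdj_adj X hadj, sqrt_mul_one_div_sqrt hk hk' hε hD]
    refine ⟨by positivity, ?_⟩
    simp only [smul_smul]
    have hε0 : ε ≠ 0 := left_ne_zero_of_mul hD.ne'
    convert one_smul ℝ X
    field_simp
    -- The scalars left are `(k' / 3)(k / 3)² D` from the two gradients, against `27 ε / (k² k' ε
    -- D)`.
    norm_num
  have hright : ∀ ξ, 0 < f ξ → M.y₁ ξ ≠ 0 →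
      0 < ε * d (ε • ((√(27 / (k * k')) * (1 / √(f ξ))) • dualQuadraticMap f ξ)) ∧
      quadraticMap d (ε • ((√(27 / (k * k')) * (1 / √(f ξ))) • dualQuadraticMap f ξ)) = ξ := by
    intro ξ hξ hξ'
    obtain ⟨Y, rfl⟩ := M.flatEquiv.surjective ξ
    rw [flatEquiv_apply] at *
    rw [y₁_flat] at hξ'
    rw [hf Y hξ'] at *
    have hD : 0 < M.dualCubic Y := pos_of_mul_pos_right hξ hk'.le
    rw [hd, hq, M.dualQuadraticMap_eq hf Y hξ']
    simp only [smul_smul]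
    set c := √(27 / (k * k')) * (1 / √(k' * M.dualCubic Y)) with hc
    have hc0 : 0 < c := by positivity
    have hc2 : c ^ 2 = 27 / (k * k') / (k' * M.dualCubic Y) := by
      rw [hc, mul_one_div, div_pow, Real.sq_sqrt (by positivity), Real.sq_sqrt hξ.le]
    rw [cubic_smul, M.cubic_dualAdj Y hξ', adj_smul, M.adj_dualAdj Y hξ']
    constructor
    -- The cubic `d` contributes `ε³`, so `ε d` is positive; in the quadratic map below only `ε² =
    -- 1` appears, so both signs are preimages of the same point.
    · have : ε * (k * ((ε * (c * (k' / 3))) ^ 3 * M.dualCubic Y ^ 2)) =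
        (ε * ε) ^ 2 * (k * ((c * (k' / 3)) ^ 3 * M.dualCubic Y ^ 2)) := by ring
      rw [this, hε2]
      positivity
    · simp only [smul_smul]
      have : k / 3 * ((ε * (c * (k' / 3))) ^ 2 * M.dualCubic Y) = 1 := by
        have : (ε * (c * (k' / 3))) ^ 2 = (ε * ε) * c ^ 2 * (k' / 3) ^ 2 := by ring
        rw [this, hε2, hc2]
        field_simp
        norm_num
      rw [this, one_smul]
  have hmaps : Set.MapsTo (quadraticMap d) {X | 0 < ε * d X ∧ M.y₁ (quadraticMap d X) ≠ 0}
      {ξ | 0 < f ξ ∧ M.y₁ ξ ≠ 0} := fun X hX => ⟨(hleft X hX.1 hX.2).1, hX.2⟩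
  have hinv : Set.InvOn (fun ξ => ε • ((√(27 / (k * k')) * (1 / √(f ξ))) • dualQuadraticMap f ξ))
      (quadraticMap d) {X | 0 < ε * d X ∧ M.y₁ (quadraticMap d X) ≠ 0}
      {ξ | 0 < f ξ ∧ M.y₁ ξ ≠ 0} :=
    ⟨fun X hX => (hleft X hX.1 hX.2).2, fun ξ hξ => (hright ξ hξ.1 hξ.2).2⟩
  refine ⟨hopen, hopen', hinv.bijOn hmaps fun ξ hξ => ?_, hinv, hqc.contDiffOn, ?_⟩
  · refine ⟨(hright ξ hξ.1 hξ.2).1, ?_⟩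
    rw [(hright ξ hξ.1 hξ.2).2]
    exact hξ.2
  · have hsub : {ξ | 0 < f ξ ∧ M.y₁ ξ ≠ 0} ⊆ {ξ | M.y₁ ξ ≠ 0} := fun ξ hξ => hξ.2
    have h₁ : ContDiffOn ℝ ∞ (fun ξ => √(27 / (k * k')) * (1 / √(f ξ)))
        {ξ | 0 < f ξ ∧ M.y₁ ξ ≠ 0} :=
      contDiffOn_const.mul (contDiffOn_const.div ((hfc.mono hsub).sqrt fun ξ hξ => hξ.1.ne')
        fun ξ hξ => (Real.sqrt_pos.2 hξ.1).ne')
    have h₂ : ContDiffOn ℝ ∞ (quadraticMap f) {ξ | 0 < f ξ ∧ M.y₁ ξ ≠ 0} :=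
      (contDiffOn_const (c := (1 / 3 : ℝ))).smul
        ((hfc.fderiv_of_isOpen (m := ∞) M.isOpen_y₁_ne (by simp)).mono hsub)
    have hb : ContDiff ℝ ∞ (bidualEquiv M.Herm).symm :=
      ContinuousLinearMap.contDiff (𝕜 := ℝ)
        (E := StrongDual ℝ (StrongDual ℝ M.Herm)) (F := M.Herm)
        (LinearMap.toContinuousLinearMap ((bidualEquiv M.Herm).symm :
          StrongDual ℝ (StrongDual ℝ M.Herm) →ₗ[ℝ] M.Herm))
    have h₃ : ContDiffOn ℝ ∞ (dualQuadraticMap f) {ξ | 0 < f ξ ∧ M.y₁ ξ ≠ 0} :=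
      hb.comp_contDiffOn h₂
    exact (contDiffOn_const (c := ε)).smul (h₁.smul h₃)

end MetricCliffordModule

end SpecialVinberg

end

/-! ### The main theorem, from the two signs `ε = 1` and `ε = -1` -/

open SpecialVinberg
theorem mainTheorem3 {V S : Type*} [NormedAddCommGroup V] [InnerProductSpace ℝ V]
    [FiniteDimensional ℝ V] [NormedAddCommGroup S] [InnerProductSpace ℝ S]
    [FiniteDimensional ℝ S] [Module (CliffordAlgebra (negForm V)) S]
    [IsScalarTower ℝ (CliffordAlgebra (negForm V)) S] (M : MetricCliffordModule V S)
    (d : M.Herm → ℝ) (hd : M.IsInvariantCubic d)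
    (r : RationalFunction (StrongDual ℝ M.Herm)) (hr : M.IsDualInvariantCubic r)
    (k k' : ℝ) (hk : d M.one = k) (hk0 : 0 < k)
    (hk' : r.eval (M.flat M.one) = k') (hk0' : 0 < k') :
    (∀ X, d X = k * M.cubic X) ∧
    (∀ X : M.Herm, M.y₁ (M.flat X) ≠ 0 →
      r.RegularAt (M.flat X) ∧ r.eval (M.flat X) = k' * M.dualCubic X) ∧
    IsDiffeoWithInverse (quadraticMap d)
      (fun ξ => (√(27 / (k * k')) * (1 / √(r.eval ξ))) • dualQuadraticMap r.eval ξ)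
      (M.Hpos d) (M.Hpos' r) ∧
    IsDiffeoWithInverse (quadraticMap d)
      (fun ξ => -((√(27 / (k * k')) * (1 / √(r.eval ξ))) • dualQuadraticMap r.eval ξ))
      (M.Hneg d) (M.Hpos' r) := by
  have h₁ : ∀ X, d X = k * M.cubic X := fun X => hk ▸ M.eq_cubic_of_isInvariantCubic hd X
  have h₂ : ∀ X : M.Herm, (M.toMat X).x₁ ≠ 0 →
      r.RegularAt (M.flat X) ∧ r.eval (M.flat X) = k' * M.dualCubic X := fun X hX =>
    hk' ▸ M.eq_dualCubic_of_isDualInvariantCubic hr (hk' ▸ hk0'.ne') X hX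
  refine ⟨h₁, fun X hX => h₂ X (by rwa [M.y₁_flat] at hX), ?_, ?_⟩
  · have := M.isDiffeoWithInverse_quadraticMap hk0 hk0' h₁ (fun X hX => (h₂ X hX).2)
      (Or.inl (rfl : (1 : ℝ) = 1))
    simp only [one_smul, one_mul] at this
    exact this
  · have := M.isDiffeoWithInverse_quadraticMap hk0 hk0' h₁ (fun X hX => (h₂ X hX).2)
      (Or.inr (rfl : (-1 : ℝ) = -1))
    simp only [neg_one_smul, neg_one_mul, neg_pos] at this
    exact this
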